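/- Let $\mathfrak K$ be a field, let $\Gamma$ be a finite quiver without oriented cycles, and let $\Lambda=\mathfrak K\Gamma/I$, where $I$ is an admissible ideal of the path algebra generated by paths (so $\Lambda$ is a triangular monomial algebra). Paths are composed from right to left, $s(\cdot)$ and $t(\cdot)$ denote start and end points, and $J$ is the Jacobson radical of $\Lambda$. Let $U$ be a finitely generated uniserial left $\Lambda$-module (one with exactly one composition series), of length $n$, with mast $$p=\alpha_{n-1}\cdots\alpha_1,\qquad 1\xrightarrow{\alpha_1}2\xrightarrow{\alpha_2}\cdots\xrightarrow{\alpha_{n-1}}n,$$ that is, $p$ is a path of length $n-1$ in $\Gamma$ with $pU\neq 0$; its (pairwise distinct) vertices are labelled $1,\dots,n$. An empty product of the $\alpha_i$ stands for the trivial path at the vertex in question. Define the following sets of arrows of $\Gamma$: - $B$: the arrows $\beta$ with $s(\beta)\in\{1,\dots,n-1\}$ and $t(\beta)\notin\{1,\dots,n\}$; - $B'$: the arrows $\beta'$ with $s(\beta')=n$; - $C$: the arrows $\gamma$ with $s(\gamma)\notin\{1,\dots,n\}$ and $t(\gamma)\in\{2,\dots,n\}$; - $D$: the arrows $\delta\notin\{\alpha_1,\dots,\alpha_{n-1}\}$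 with $s(\delta),t(\delta)\in\{1,\dots,n\}$. Call a homomorphism $f$ of finitely generated left $\Lambda$-modules irreducible if it is neither a split monomorphism nor a split epimorphism and, whenever $f=hg$ with $g,h$ homomorphisms of finitely generated left $\Lambda$-modules, $g$ is a split monomorphism or $h$ is a split epimorphism. Then the following statements are equivalent: (1) The embedding $JU\hookrightarrow U$ is irreducible. (2) $U$ is not simple, and both (a) and (b) hold (all equations in $\Lambda$): (a) (i) $\beta\,\alpha_{s(\beta)-1}\cdots\alpha_1=0$ for every $\beta\in B$, and (ii) $\delta\,\alpha_{s(\delta)-1}\cdots\alpha_1=0$ for every $\delta\in D$. (b) For every $\beta'\in B'$ with $\beta'p\neq 0$: (i) $\beta'\alpha_{n-1}\cdots\alpha_{t(\gamma)}\gamma=0$ for every $\gamma\in C$, and (ii) $\beta'\alpha_{n-1}\cdots\alpha_{t(\delta)}\delta=0$ for every $\delta\in D$. -/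

import Mathlib

universe u v w x

noncomputable section

open Quiver

/-! ### The path algebra of a finite quiver -/

/-- The path algebra `K Γ` of a quiver with finitely many vertices: an element is a finitely
supported family of coefficients on the paths `a → b`, for each pair of vertices `a`, `b`. -/
def PathAlgebra (K : Type u) (Γ : Type v) [Field K] [Quiver.{w} Γ] : Type (max u v w) :=
  ∀ a b : Γ, Path a b →₀ K

namespace PathAlgebra

section Basic

variable {K : Type u} {Γ : Type v} [Field K] [Quiver.{w} Γ]

instance : AddCommGroup (PathAlgebra K Γ) :=
  inferInstanceAs (AddCommGroup (∀ a b : Γ, Path a b →₀ K))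

instance : Module K (PathAlgebra K Γ) :=
  inferInstanceAs (Module K (∀ a b : Γ, Path a b →₀ K))

@[ext]
theorem ext {f g : PathAlgebra K Γ} (h : ∀ a b, f a b = g a b) : f = g :=
  funext fun a => funext fun b => h a b

@[simp] theorem add_apply (f g : PathAlgebra K Γ) (a b : Γ) : (f + g) a b = f a b + g a b := rfl

@[simp] theorem zero_apply (a b : Γ) : (0 : PathAlgebra K Γ) a b = 0 := rfl

@[simp] theorem smul_apply (k : K) (f : PathAlgebra K Γ) (a b : Γ) : (k • f) a b = k • f a b := rfl

/-- The bilinear extension of concatenation of paths: `(q, p) ↦ qp` ("first `p`, then `q`"). -/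
def concat (a c b : Γ) : (Path c b →₀ K) →ₗ[K] (Path a c →₀ K) →ₗ[K] (Path a b →₀ K) :=
  Finsupp.linearCombination K fun q : Path c b =>
    Finsupp.lmapDomain K K fun p : Path a c => p.comp q

@[simp]
theorem concat_single {a c b : Γ} (q : Path c b) (p : Path a c) (s t : K) :
    concat a c b (Finsupp.single q s) (Finsupp.single p t)
      = Finsupp.single (p.comp q) (s * t) := by
  simp [concat, Finsupp.linearCombination_single, Finsupp.mapDomain_single]

theorem concat_assoc {a b c d : Γ} (h : Path c d →₀ K) (g : Path b c →₀ K) (f : Path a b →₀ K) :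
    concat a b d (concat b c d h g) f = concat a c d h (concat a b c g f) := by
  induction h using Finsupp.induction_linear with
  | zero => simp
  | add h₁ h₂ e₁ e₂ => simp [e₁, e₂]
  | single r k =>
    induction g using Finsupp.induction_linear with
    | zero => simp
    | add g₁ g₂ e₁ e₂ => simp [e₁, e₂]
    | single q l =>
      induction f using Finsupp.induction_linear with
      | zero => simp
      | add f₁ f₂ e₁ e₂ => simp only [map_add, e₁, e₂]
      | single p m => simp only [concat_single, mul_assoc, Path.comp_assoc]

theorem concat_nil_left {a b : Γ} (f : Path a b →₀ K) :
    concat a b b (Finsupp.single Path.nil 1) f = f := by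
  induction f using Finsupp.induction_linear with
  | zero => simp
  | add f₁ f₂ e₁ e₂ => simp [e₁, e₂]
  | single p m => simp

theorem concat_nil_right {a b : Γ} (f : Path a b →₀ K) :
    concat a a b f (Finsupp.single Path.nil 1) = f := by
  induction f using Finsupp.induction_linear with
  | zero => simp
  | add f₁ f₂ e₁ e₂ => simp [e₁, e₂]
  | single p m => simp

/-- The product, in which paths are composed from right to left. -/
instance [Fintype Γ] : Mul (PathAlgebra K Γ) :=
  ⟨fun f g a b => ∑ c, concat a c b (f c b) (g a c)⟩

theorem mul_apply [Fintype Γ] (f g : PathAlgebra K Γ) (a b : Γ) :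
    (f * g) a b = ∑ c, concat a c b (f c b) (g a c) := rfl

theorem sum_apply {ι : Type*} (s : Finset ι) (F : ι → PathAlgebra K Γ) (a b : Γ) :
    (∑ i ∈ s, F i) a b = ∑ i ∈ s, F i a b := by
  induction s using Finset.cons_induction with
  | empty => simp
  | cons i s hi ih => simp [Finset.sum_cons, ih]

end Basic

section Ring

variable {K : Type u} {Γ : Type v} [Field K] [Quiver.{w} Γ] [DecidableEq Γ]

/-- A path of `Γ`, as an element of the path algebra. -/
def ofPath (K : Type u) {Γ : Type v} [Field K] [Quiver.{w} Γ] [DecidableEq Γ] {a b : Γ}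
    (p : Path a b) : PathAlgebra K Γ :=
  Pi.single a (Pi.single b (Finsupp.single p 1))

theorem ofPath_apply_self {a b : Γ} (p : Path a b) : ofPath K p a b = Finsupp.single p 1 := by
  simp [ofPath]

theorem ofPath_apply_of_source_ne {a b a' b' : Γ} (p : Path a b) (h : a' ≠ a) :
    ofPath K p a' b' = 0 := by
  simp [ofPath, Pi.single_eq_of_ne h]

theorem ofPath_apply_of_target_ne {a b a' b' : Γ} (p : Path a b) (h : b' ≠ b) :
    ofPath K p a' b' = 0 := by
  by_cases ha : a' = a
  · subst ha
    simp [ofPath, Pi.single_eq_of_ne h]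
  · exact ofPath_apply_of_source_ne p ha

variable [Fintype Γ]

/-- The unit is the sum of the trivial paths. -/
instance : One (PathAlgebra K Γ) := ⟨∑ a : Γ, ofPath K (Path.nil : Path a a)⟩

theorem one_def : (1 : PathAlgebra K Γ) = ∑ a : Γ, ofPath K (Path.nil : Path a a) := rfl

theorem one_apply_self (a : Γ) : (1 : PathAlgebra K Γ) a a = Finsupp.single Path.nil 1 := by
  rw [one_def, sum_apply, Finset.sum_eq_single a]
  · exact ofPath_apply_self _
  · intro b _ hb
    exact ofPath_apply_of_source_ne _ hb.symm
  · simp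

theorem one_apply_ne {a b : Γ} (h : a ≠ b) : (1 : PathAlgebra K Γ) a b = 0 := by
  rw [one_def, sum_apply]
  refine Finset.sum_eq_zero fun c _ => ?_
  by_cases hc : a = c
  · exact ofPath_apply_of_target_ne _ fun hb => h (hc.trans hb.symm)
  · exact ofPath_apply_of_source_ne _ hc

instance : Ring (PathAlgebra K Γ) :=
  { (inferInstance : AddCommGroup (PathAlgebra K Γ)) with
    mul := (· * ·)
    one := 1
    zero_mul := fun f => by ext1 a b; simp [mul_apply]
    mul_zero := fun f => by ext1 a b; simp [mul_apply]
    left_distrib := fun f g h => by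
      ext1 a b; simp [mul_apply, Finset.sum_add_distrib]
    right_distrib := fun f g h => by
      ext1 a b; simp [mul_apply, Finset.sum_add_distrib]
    mul_assoc := fun f g h => by
      ext1 a b
      simp only [mul_apply, map_sum, LinearMap.sum_apply]
      rw [Finset.sum_comm]
      simp only [concat_assoc]
    one_mul := fun f => by
      ext1 a b
      rw [mul_apply, Finset.sum_eq_single b]
      · rw [one_apply_self, concat_nil_left]
      · intro c _ hc
        rw [one_apply_ne hc]; simp
      · simp
    mul_one := fun f => by
      ext1 a b
      rw [mul_apply, Finset.sum_eq_single a]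
      · rw [one_apply_self, concat_nil_right]
      · intro c _ hc
        rw [one_apply_ne hc.symm]; simp
      · simp }

instance : Algebra K (PathAlgebra K Γ) :=
  Algebra.ofModule
    (fun k f g => by ext1 a b; simp [mul_apply, Finset.smul_sum])
    (fun k f g => by ext1 a b; simp [mul_apply, Finset.smul_sum])

/-- Products are composed from right to left: `q * p` is the path `p` followed by `q`. -/
theorem ofPath_mul_ofPath {a b c : Γ} (q : Path b c) (p : Path a b) :
    ofPath K q * ofPath K p = ofPath K (p.comp q) := by
  ext1 x y
  rw [mul_apply, Finset.sum_eq_single b]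
  · by_cases hx : x = a
    · subst hx
      by_cases hy : y = c
      · subst hy
        simp [ofPath_apply_self]
      · simp [ofPath_apply_of_target_ne _ hy]
    · simp [ofPath_apply_of_source_ne _ hx]
  · intro z _ hz
    simp [ofPath_apply_of_source_ne _ hz]
  · simp

theorem ofPath_mul_ofPath_of_ne {a b c d : Γ} (q : Path c d) (p : Path a b) (h : b ≠ c) :
    ofPath K q * ofPath K p = 0 := by
  ext1 x y
  rw [mul_apply]
  refine Finset.sum_eq_zero fun z _ => ?_
  by_cases hz : z = c
  · subst hz
    simp [ofPath_apply_of_target_ne p h.symm]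
  · simp [ofPath_apply_of_source_ne q hz]

end Ring

end PathAlgebra

/-! ### Bound quiver algebras -/

section BoundQuiver

variable {K : Type u} {Γ : Type v} [Field K] [Quiver.{w} Γ] [DecidableEq Γ] [Fintype Γ]

/-- The quiver has no oriented cycles. -/
def IsTriangularQuiver (Γ : Type v) [Quiver.{w} Γ] : Prop :=
  ∀ (a : Γ) (c : Path a a), c = Path.nil

/-- The `m`-th power of the ideal generated by the arrows, i.e. the ideal generated by
all paths of length at least `m`. -/
def arrowIdealPow (K : Type u) (Γ : Type v) [Field K] [Quiver.{w} Γ] [DecidableEq Γ] [Fintype Γ]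
    (m : ℕ) : TwoSidedIdeal (PathAlgebra K Γ) :=
  TwoSidedIdeal.span {f | ∃ (a b : Γ) (p : Path a b), m ≤ p.length ∧ f = PathAlgebra.ofPath K p}

/-- `I` is admissible: it contains some power of the arrow ideal and is contained in
its square. -/
def IsAdmissibleIdeal (I : TwoSidedIdeal (PathAlgebra K Γ)) : Prop :=
  (∃ m : ℕ, arrowIdealPow K Γ m ≤ I) ∧ I ≤ arrowIdealPow K Γ 2

/-- `I` is monomial: it is generated by a set of paths. -/
def IsMonomialIdeal (I : TwoSidedIdeal (PathAlgebra K Γ)) : Prop :=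
  ∃ S : Set (Σ a b : Γ, Path a b),
    I = TwoSidedIdeal.span ((fun s => PathAlgebra.ofPath K s.2.2) '' S)

/-- The algebra `Λ = K Γ / I`. -/
abbrev BoundQuiverAlgebra (I : TwoSidedIdeal (PathAlgebra K Γ)) : Type (max u v w) :=
  I.ringCon.Quotient

/-- The class in `Λ = K Γ / I` of a path of `Γ`. -/
def pathClass (I : TwoSidedIdeal (PathAlgebra K Γ)) {a b : Γ} (p : Path a b) :
    BoundQuiverAlgebra I :=
  I.ringCon.mk' (PathAlgebra.ofPath K p)

/-- The class in `Λ = K Γ / I` of an arrow of `Γ`. -/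
def arrowClass (I : TwoSidedIdeal (PathAlgebra K Γ)) {a b : Γ} (α : a ⟶ b) :
    BoundQuiverAlgebra I :=
  pathClass I α.toPath

/-- `p` is a mast of `U`: `U` has finite length `n = length p + 1` and `p x ≠ 0` for
some `x ∈ U`. -/
def IsMast (I : TwoSidedIdeal (PathAlgebra K Γ)) (U : Type x) [AddCommGroup U]
    [Module (BoundQuiverAlgebra I) U] {a b : Γ} (p : Path a b) : Prop :=
  Module.length (BoundQuiverAlgebra I) U = (p.length : ℕ∞) + 1 ∧
    ∃ x : U, pathClass I p • x ≠ 0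

end BoundQuiver

/-! ### Arrows touching a path

`p : Path a b` runs from its first vertex `a` to its last vertex `b`; `p.vertices` lists all the
vertices it passes through (they are distinct if the quiver has no oriented cycles). -/

section Touching

variable {Γ : Type v} [Quiver.{w} Γ] {a b : Γ}

/-- `u` is a right subpath of `p`, `p = r u`: an initial segment. In a quiver without
oriented cycles there is exactly one right subpath of `p` ending in a given vertex of `p`. -/
def IsRightSubpath {x : Γ} (u : Path a x) (p : Path a b) : Prop :=
  ∃ r : Path x b, p = u.comp r

/-- `r` is a left subpath of `p`, `p = r u`: a terminal segment. In a quiver without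
oriented cycles there is exactly one left subpath of `p` starting in a given vertex of `p`. -/
def IsLeftSubpath {x : Γ} (r : Path x b) (p : Path a b) : Prop :=
  ∃ u : Path a x, p = u.comp r

/-- `α` is one of the arrows of `p`. -/
def IsArrowOf {x y : Γ} (α : x ⟶ y) (p : Path a b) : Prop :=
  ∃ (u : Path a x) (r : Path y b), p = (u.cons α).comp r

/-- The class `B`: arrows from a vertex of `p` other than the last one to a vertex off `p`. -/
def IsB (p : Path a b) {x y : Γ} (_β : x ⟶ y) : Prop :=
  x ∈ p.vertices ∧ x ≠ b ∧ y ∉ p.vertices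

/-- The class `B'`: arrows starting in the last vertex of `p`. -/
def IsB' (_p : Path a b) {x y : Γ} (_β : x ⟶ y) : Prop :=
  x = b

/-- The class `C`: arrows from a vertex off `p` to a vertex of `p` other than the first one. -/
def IsC (p : Path a b) {x y : Γ} (_γ : x ⟶ y) : Prop :=
  x ∉ p.vertices ∧ y ∈ p.vertices ∧ y ≠ a

/-- The class `D`: arrows between vertices of `p` which are not arrows of `p`. -/
def IsD (p : Path a b) {x y : Γ} (δ : x ⟶ y) : Prop :=
  x ∈ p.vertices ∧ y ∈ p.vertices ∧ ¬ IsArrowOf δ p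

end Touching

/-! ### Modules -/

section Modules

/-- A uniserial module: it has exactly one composition series. -/
def IsUniserialModule (R : Type u) (U : Type x) [Ring R] [AddCommGroup U] [Module R U] : Prop :=
  ∃! s : CompositionSeries (Submodule R U), s.head = ⊥ ∧ s.last = ⊤

variable {R : Type u} [Ring R] {M N : Type x} [AddCommGroup M] [Module R M] [AddCommGroup N]
  [Module R N]

/-- `f` has a left inverse. -/
def IsSplitMonoHom (f : M →ₗ[R] N) : Prop := ∃ g : N →ₗ[R] M, g ∘ₗ f = LinearMap.id

/-- `f` has a right inverse. -/
def IsSplitEpiHom (f : M →ₗ[R] N) : Prop := ∃ g : N →ₗ[R] M, f ∘ₗ g = LinearMap.id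

/-- `f` is irreducible in the category of finitely generated `R`-modules: it is neither a split
monomorphism nor a split epimorphism, and in every factorization `f = h g` through a finitely
generated module, `g` is a split monomorphism or `h` is a split epimorphism. -/
def IsIrreducibleHom (f : M →ₗ[R] N) : Prop :=
  ¬ IsSplitMonoHom f ∧ ¬ IsSplitEpiHom f ∧
    ∀ (V : Type x) [AddCommGroup V] [Module R V] [Module.Finite R V]
      (g : M →ₗ[R] V) (h : V →ₗ[R] N), h ∘ₗ g = f → IsSplitMonoHom g ∨ IsSplitEpiHom h

/-- The submodule `JU`, where `J` is the Jacobson radical of `R`. -/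
def radSubmodule (R : Type u) (U : Type x) [Ring R] [AddCommGroup U] [Module R U] :
    Submodule R U :=
  Ring.jacobson R • (⊤ : Submodule R U)

end Modules

end

/-!
If `p = r u` with `u` ending in `v`, then `u x₀` spans the part of `U` at `v`, where `x₀` is a top
element of `U`; so `U` has a `K`-basis indexed by the vertices of `p`, and `JU` is the part away
from the start of `p`.

Necessity. For `r` annihilating `JU`, glue a free module of rank two to `JU` by identifying
`p x₀ ∈ JU` with `(p, r)`, and factor the embedding through this pushout `V`. The map `JU → V` does
not split because `p` and `r` annihilate `JU`, so `V → U` does. A section assigns to `x₀` an element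
satisfying all relations of `x₀`. Compare coefficients of paths, which are well defined modulo a
monomial ideal: the choice `r = 0` yields (a), and by (a) every path which joins `p` through an
arrow off `p` and follows it to its end annihilates `JU` and is a choice of `r`, which yields (b).

Sufficiency. Given a factorization `JU → V → U`, let `z ∈ V` be the image of `p x₀`. Suppose first
that `z` is the sum of some `p y` and of elements `r ε m`, where `ε` is an arrow off `p` joining `p`
after its start and `r` is the remaining part of `p`. By (a) the elements `r ε m` vanish in `U`, and
by (b) they are annihilated by the arrows `β` with `β p ≠ 0`; hence the part of `y` at the start of
`p` satisfies the relations of `x₀`, and `V → U` splits. Otherwise some functional `φ` with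
`φ z = 1` vanishes on all such sums, and `m ↦ ∑ φ (r m) u x₀`, over the factorizations `p = r u`,
retracts `V` onto `JU`.
-/

open Quiver

namespace PathAlgebra

variable {K : Type u} {Γ : Type v} [Field K] [Quiver.{w} Γ]

theorem exists_of_concat_apply_ne_zero {a c b : Γ} {f : Path c b →₀ K} {g : Path a c →₀ K}
    {q : Path a b} (h : concat a c b f g q ≠ 0) :
    ∃ (r : Path c b) (s : Path a c), f r ≠ 0 ∧ g s ≠ 0 ∧ q = s.comp r := by
  classical
  rw [concat, Finsupp.linearCombination_apply, Finsupp.sum, LinearMap.sum_apply,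
    Finsupp.finsetSum_apply] at h
  obtain ⟨r, hr, h⟩ := Finset.exists_ne_zero_of_sum_ne_zero h
  rw [LinearMap.smul_apply, Finsupp.smul_apply, Finsupp.lmapDomain_apply] at h
  have hq := Finsupp.mapDomain_support (Finsupp.mem_support_iff.2 (right_ne_zero_of_smul h))
  obtain ⟨s, hs, rfl⟩ := Finset.mem_image.1 hq
  exact ⟨r, s, Finsupp.mem_support_iff.1 hr, Finsupp.mem_support_iff.1 hs, rfl⟩

theorem concat_single_one_right_apply_comp {a c b : Γ} (f : Path c b →₀ K) (p : Path a c)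
    (q : Path c b) : concat a c b f (Finsupp.single p 1) (p.comp q) = f q := by
  induction f using Finsupp.induction_linear with
  | zero => simp
  | add f g hf hg => simp [hf, hg]
  | single r k =>
    rw [concat_single, mul_one]
    by_cases h : r = q
    · subst h; simp
    · rw [Finsupp.single_eq_of_ne (Ne.symm h), Finsupp.single_eq_of_ne]
      exact fun hpq => h (Path.comp_injective_right p hpq).symm

theorem exists_of_mul_apply_ne_zero [Fintype Γ] {f g : PathAlgebra K Γ} {a b : Γ}
    {q : Path a b} (h : (f * g) a b q ≠ 0) :
    ∃ (c : Γ) (r : Path c b) (s : Path a c), f c b r ≠ 0 ∧ g a c s ≠ 0 ∧ q = s.comp r := by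
  rw [mul_apply, Finsupp.finsetSum_apply] at h
  obtain ⟨c, -, h⟩ := Finset.exists_ne_zero_of_sum_ne_zero h
  exact ⟨c, exists_of_concat_apply_ne_zero h⟩

variable [DecidableEq Γ]

theorem sigma_eq_of_ofPath_apply_ne_zero {a b a' b' : Γ} {p : Path a b} {q : Path a' b'}
    (h : ofPath K p a' b' q ≠ 0) : (⟨a, b, p⟩ : Σ a b : Γ, Path a b) = ⟨a', b', q⟩ := by
  by_cases ha : a' = a
  · subst ha
    by_cases hb : b' = b
    · subst hb
      rw [ofPath_apply_self] at h
      rw [← (Finsupp.single_apply_ne_zero.1 h).1]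
    · exact absurd (by rw [ofPath_apply_of_target_ne _ hb]; rfl) h
  · exact absurd (by rw [ofPath_apply_of_source_ne _ ha]; rfl) h

variable [Fintype Γ]

theorem eq_sum_smul_ofPath (f : PathAlgebra K Γ) :
    f = ∑ a, ∑ b, ∑ q ∈ (f a b).support, f a b q • ofPath K q := by
  ext1 a b
  rw [sum_apply, Finset.sum_eq_single a, sum_apply, Finset.sum_eq_single b, sum_apply]
  · conv_lhs => rw [← Finsupp.sum_single (f a b)]
    refine Finset.sum_congr rfl fun q _ => ?_
    rw [smul_apply, ofPath_apply_self, Finsupp.smul_single, smul_eq_mul, mul_one]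
  · intro c _ hc
    rw [sum_apply]
    refine Finset.sum_eq_zero fun q _ => ?_
    rw [smul_apply, ofPath_apply_of_target_ne _ hc.symm, smul_zero]
  · simp
  · intro c _ hc
    simp_rw [sum_apply]
    refine Finset.sum_eq_zero fun d _ => Finset.sum_eq_zero fun q _ => ?_
    rw [smul_apply, ofPath_apply_of_source_ne _ hc.symm, smul_zero]
  · simp

@[elab_as_elim]
theorem induction_ofPath {P : PathAlgebra K Γ → Prop} (f : PathAlgebra K Γ)
    (zero : P 0) (add : ∀ f g, P f → P g → P (f + g))
    (smul_ofPath : ∀ (k : K) {a b : Γ} (p : Path a b), P (k • ofPath K p)) : P f := by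
  rw [eq_sum_smul_ofPath f]
  exact Finset.sum_induction _ P add zero fun a _ => Finset.sum_induction _ P add zero
    fun b _ => Finset.sum_induction _ P add zero fun q _ => smul_ofPath _ q

theorem mul_ofPath_apply_comp {a b c : Γ} (f : PathAlgebra K Γ) (p : Path a b) (q : Path b c) :
    (f * ofPath K p) a c (p.comp q) = f b c q := by
  rw [mul_apply, Finset.sum_eq_single b]
  · rw [ofPath_apply_self, concat_single_one_right_apply_comp]
  · intro d _ hd
    rw [ofPath_apply_of_target_ne _ hd, map_zero]
  · simp

theorem isRightSubpath_of_mul_ofPath_apply_ne_zero {a b c : Γ} {f : PathAlgebra K Γ}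
    {p : Path a b} {q : Path a c} (h : (f * ofPath K p) a c q ≠ 0) : IsRightSubpath p q := by
  obtain ⟨d, r, s, -, hs, rfl⟩ := exists_of_mul_apply_ne_zero h
  cases sigma_eq_of_ofPath_apply_ne_zero hs
  exact ⟨r, rfl⟩

theorem isLeftSubpath_of_ofPath_mul_apply_ne_zero {a b c : Γ} {f : PathAlgebra K Γ}
    {p : Path a b} {q : Path c b} (h : (ofPath K p * f) c b q ≠ 0) : IsLeftSubpath p q := by
  obtain ⟨d, r, s, hr, -, rfl⟩ := exists_of_mul_apply_ne_zero h
  cases sigma_eq_of_ofPath_apply_ne_zero hr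
  exact ⟨s, rfl⟩

/-- The largest monomial ideal contained in `I`: it consists of the elements all of whose paths
belong to `I`. -/
noncomputable def monomialCore (I : TwoSidedIdeal (PathAlgebra K Γ)) :
    TwoSidedIdeal (PathAlgebra K Γ) :=
  TwoSidedIdeal.mk' {f | ∀ ⦃a b : Γ⦄ ⦃q : Path a b⦄, f a b q ≠ 0 → ofPath K q ∈ I}
    (fun _ _ _ h => absurd rfl h)
    (fun {f g} hf hg a b q h => by
      by_contra hq
      refine h ?_
      rw [add_apply, Finsupp.add_apply, not_not.1 (mt (@hf a b q) hq),
        not_not.1 (mt (@hg a b q) hq), add_zero])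
    (fun {_} hf _ _ _ h => hf fun hq => h (neg_eq_zero.2 hq))
    (fun {_ _} hg _ _ _ h => by
      obtain ⟨_, r, s, -, hs, rfl⟩ := exists_of_mul_apply_ne_zero h
      rw [← ofPath_mul_ofPath]
      exact I.mul_mem_left _ _ (hg hs))
    (fun {_ _} hf _ _ _ h => by
      obtain ⟨_, r, s, hr, -, rfl⟩ := exists_of_mul_apply_ne_zero h
      rw [← ofPath_mul_ofPath]
      exact I.mul_mem_right _ _ (hf hr))

theorem mem_monomialCore_iff {I : TwoSidedIdeal (PathAlgebra K Γ)} {f : PathAlgebra K Γ} :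
    f ∈ monomialCore I ↔ ∀ ⦃a b : Γ⦄ ⦃q : Path a b⦄, f a b q ≠ 0 → ofPath K q ∈ I := by
  rw [monomialCore, TwoSidedIdeal.mem_mk', Set.mem_ofPred_eq]

end PathAlgebra

section BoundQuiverAlgebra

open PathAlgebra

variable {K : Type u} {Γ : Type v} [Field K] [Quiver.{w} Γ] [DecidableEq Γ] [Fintype Γ]
  {I : TwoSidedIdeal (PathAlgebra K Γ)}

theorem pathClass_eq_zero_iff {a b : Γ} {p : Path a b} :
    pathClass I p = 0 ↔ ofPath K p ∈ I := by
  rw [TwoSidedIdeal.mem_iff, pathClass, ← map_zero I.ringCon.mk']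
  exact I.ringCon.eq

theorem pathClass_mul {a b c : Γ} (q : Path b c) (p : Path a b) :
    pathClass I q * pathClass I p = pathClass I (p.comp q) := by
  rw [pathClass, pathClass, ← map_mul, ofPath_mul_ofPath, pathClass]

theorem pathClass_mul_of_ne {a b c d : Γ} (q : Path c d) (p : Path a b) (h : b ≠ c) :
    pathClass I q * pathClass I p = 0 := by
  rw [pathClass, pathClass, ← map_mul, ofPath_mul_ofPath_of_ne _ _ h, map_zero]

theorem arrowClass_mul_pathClass {a b c : Γ} (α : b ⟶ c) (p : Path a b) :
    arrowClass I α * pathClass I p = pathClass I (p.cons α) :=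
  pathClass_mul _ _

theorem pathClass_mul_arrowClass {a b c : Γ} (q : Path b c) (α : a ⟶ b) :
    pathClass I q * arrowClass I α = pathClass I (α.toPath.comp q) :=
  pathClass_mul _ _

theorem sum_pathClass_nil (I : TwoSidedIdeal (PathAlgebra K Γ)) :
    ∑ a : Γ, pathClass I (Path.nil : Path a a) = 1 := by
  rw [← map_one I.ringCon.mk', one_def, map_sum]
  rfl

@[elab_as_elim]
theorem BoundQuiverAlgebra.induction_on {P : BoundQuiverAlgebra I → Prop}
    (c : BoundQuiverAlgebra I) (zero : P 0) (add : ∀ c d, P c → P d → P (c + d))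
    (smul_pathClass : ∀ (k : K) {a b : Γ} (p : Path a b), P (k • pathClass I p)) : P c := by
  obtain ⟨f, rfl⟩ := I.ringCon.mk'_surjective c
  induction f using induction_ofPath with
  | zero => simpa using zero
  | add f g hf hg => simpa using add _ _ hf hg
  | smul_ofPath k p => exact smul_pathClass k p

namespace IsMonomialIdeal

theorem ofPath_mem (hI : IsMonomialIdeal I) {f : PathAlgebra K Γ} (hf : f ∈ I)
    {a b : Γ} {q : Path a b} (hq : f a b q ≠ 0) : ofPath K q ∈ I := by
  have hle : I ≤ monomialCore I := by
    obtain ⟨S, hS⟩ := hI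
    conv_lhs => rw [hS]
    rw [TwoSidedIdeal.span_le]
    rintro _ ⟨s, hs, rfl⟩
    refine mem_monomialCore_iff.2 fun a b q h => ?_
    cases sigma_eq_of_ofPath_apply_ne_zero h
    rw [hS]
    exact TwoSidedIdeal.subset_span ⟨_, hs, rfl⟩
  exact mem_monomialCore_iff.1 (hle hf) hq

variable (hI : IsMonomialIdeal I)

/-- The coefficient of a path `q` as a linear functional on the bound quiver algebra. It is well
defined since `q ∉ I` cannot occur in an element of the monomial ideal `I`. -/
noncomputable def pathCoeff {a b : Γ} {q : Path a b} (hq : pathClass I q ≠ 0) :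
    BoundQuiverAlgebra I →ₗ[K] K where
  toFun := Quotient.lift (fun f : PathAlgebra K Γ => f a b q) fun f g hfg => by
    by_contra h
    exact hq (pathClass_eq_zero_iff.2
      (hI.ofPath_mem (I.rel_iff f g |>.1 hfg) fun h0 => h (sub_eq_zero.1 h0)))
  map_add' := by
    rintro ⟨f⟩ ⟨g⟩
    rfl
  map_smul' := by
    rintro k ⟨f⟩
    rfl

@[simp]
theorem pathCoeff_pathClass_self {a b : Γ} {q : Path a b} (hq : pathClass I q ≠ 0) :
    hI.pathCoeff hq (pathClass I q) = 1 := by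
  change ofPath K q a b q = 1
  rw [ofPath_apply_self, Finsupp.single_eq_same]

theorem pathCoeff_pathClass_of_ne {a b : Γ} {q r : Path a b} (hq : pathClass I q ≠ 0)
    (h : r ≠ q) : hI.pathCoeff hq (pathClass I r) = 0 := by
  change ofPath K r a b q = 0
  rw [ofPath_apply_self, Finsupp.single_eq_of_ne h.symm]

theorem pathCoeff_comp_mul_pathClass {a b c : Γ} {p : Path a b} {q : Path b c}
    (hpq : pathClass I (p.comp q) ≠ 0) (hq : pathClass I q ≠ 0) (d : BoundQuiverAlgebra I) :
    hI.pathCoeff hpq (d * pathClass I p) = hI.pathCoeff hq d := by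
  obtain ⟨f, rfl⟩ := I.ringCon.mk'_surjective d
  exact mul_ofPath_apply_comp f p q

theorem isRightSubpath_of_pathCoeff_mul_ne_zero {a b c : Γ} {p : Path a b} {q : Path a c}
    {hq : pathClass I q ≠ 0} {d : BoundQuiverAlgebra I}
    (h : hI.pathCoeff hq (d * pathClass I p) ≠ 0) : IsRightSubpath p q := by
  obtain ⟨f, rfl⟩ := I.ringCon.mk'_surjective d
  exact isRightSubpath_of_mul_ofPath_apply_ne_zero h

theorem isLeftSubpath_of_pathCoeff_mul_ne_zero {a b c : Γ} {p : Path a b} {q : Path c b}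
    {hq : pathClass I q ≠ 0} {d : BoundQuiverAlgebra I}
    (h : hI.pathCoeff hq (pathClass I p * d) ≠ 0) : IsLeftSubpath p q := by
  obtain ⟨f, rfl⟩ := I.ringCon.mk'_surjective d
  exact isLeftSubpath_of_ofPath_mul_apply_ne_zero h

end IsMonomialIdeal

end BoundQuiverAlgebra

section TriangularQuiver

variable {Γ : Type v} [Quiver.{w} Γ] {a b : Γ} {p : Path a b}

theorem IsRightSubpath.target_mem {x : Γ} {u : Path a x} (h : IsRightSubpath u p) :
    x ∈ p.vertices := by
  obtain ⟨r, rfl⟩ := h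
  rw [Path.vertices_comp, List.mem_append]
  exact Or.inr r.start_mem_vertices

theorem IsLeftSubpath.source_mem {x : Γ} {r : Path x b} (h : IsLeftSubpath r p) :
    x ∈ p.vertices := by
  obtain ⟨u, h⟩ := h
  exact IsRightSubpath.target_mem ⟨r, h⟩

theorem IsArrowOf.target_mem {x y : Γ} {α : x ⟶ y} (h : IsArrowOf α p) : y ∈ p.vertices := by
  obtain ⟨u, r, h⟩ := h
  exact IsRightSubpath.target_mem ⟨r, h⟩

theorem IsArrowOf.source_mem {x y : Γ} {α : x ⟶ y} (h : IsArrowOf α p) : x ∈ p.vertices := by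
  obtain ⟨u, r, rfl⟩ := h
  exact IsRightSubpath.target_mem
    ⟨α.toPath.comp r, by rw [← Path.comp_assoc, Path.comp_toPath_eq_cons]⟩

namespace IsTriangularQuiver

variable (hΓ : IsTriangularQuiver Γ)
include hΓ

theorem eq_of_path_of_path (q : Path a b) (r : Path b a) : a = b := by
  have hlength := congrArg Path.length (hΓ a (q.comp r))
  rw [Path.length_comp, Path.length_nil, Nat.add_eq_zero_iff] at hlength
  exact q.eq_of_length_zero hlength.1

theorem isEmpty_path_of_hom {x y : Γ} (e : x ⟶ y) : IsEmpty (Path y x) :=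
  ⟨fun r => Path.cons_ne_nil r e (hΓ y _)⟩

theorem split_unique {x : Γ} {u u' : Path a x} {r r' : Path x b} (h : u.comp r = u'.comp r') :
    u = u' ∧ r = r' := by
  induction r with
  | nil =>
    obtain rfl := hΓ x r'
    exact ⟨h, rfl⟩
  | cons r e ih =>
    cases r' with
    | nil => exact (Path.cons_ne_nil r e (hΓ _ _)).elim
    | cons r' e' =>
      rw [Path.comp_cons, Path.comp_cons] at h
      obtain rfl := Path.obj_eq_of_cons_eq_cons h
      obtain rfl := eq_of_heq (Path.hom_heq_of_cons_eq_cons h)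
      obtain ⟨rfl, rfl⟩ := ih (eq_of_heq (Path.heq_of_cons_eq_cons h))
      exact ⟨rfl, rfl⟩

theorem vertices_nodup (p : Path a b) : p.vertices.Nodup := by
  induction p with
  | nil => simp
  | cons p e ih =>
    rw [Path.vertices_cons, List.nodup_concat]
    refine ⟨fun h => ?_, ih⟩
    obtain ⟨_, r, -⟩ := p.exists_eq_comp_of_mem_vertices h
    exact (hΓ.isEmpty_path_of_hom e).false r

theorem notMem_vertices_of_hom {w : Γ} (β : b ⟶ w) : w ∉ p.vertices := fun h =>
  have ⟨_, r, _⟩ := p.exists_eq_comp_of_mem_vertices h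
  (hΓ.isEmpty_path_of_hom β).false r

theorem target_ne_of_source_mem {x y : Γ} (ε : x ⟶ y) (hx : x ∈ p.vertices) : y ≠ a := by
  rintro rfl
  obtain ⟨u, -, -⟩ := p.exists_eq_comp_of_mem_vertices hx
  exact (hΓ.isEmpty_path_of_hom ε).false u

theorem isArrowOf_of_isLeftSubpath_toPath_comp {x y : Γ} {u : Path a y} {r : Path y b}
    {ε : x ⟶ y} (hy : y ≠ a) (h : IsLeftSubpath (u.comp r) (ε.toPath.comp r)) :
    IsArrowOf ε (u.comp r) := by
  obtain ⟨q, hq⟩ := h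
  rw [← Path.comp_assoc] at hq
  have hεu : ε.toPath = q.comp u := (hΓ.split_unique hq).1
  cases u with
  | nil => exact absurd rfl hy
  | cons u α =>
    obtain rfl := Path.obj_eq_of_cons_eq_cons hεu
    obtain rfl := eq_of_heq (Path.hom_heq_of_cons_eq_cons hεu)
    exact ⟨u, r, rfl⟩

end IsTriangularQuiver

end TriangularQuiver

section Radical

theorem mem_jacobson_of_forall_mul_mul_self_eq_zero {R : Type*} [Ring R] {q : R}
    (h : ∀ c, q * c * q = 0) : q ∈ Ring.jacobson R := by
  rw [Ring.jacobson_eq_sInf_isMaximal, Submodule.mem_sInf]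
  intro m (hm : Ideal.IsMaximal m)
  by_contra hq
  obtain ⟨c, s, hs, hcs⟩ := hm.exists_inv hq
  have hqs : q * s = q := calc
    q * s = q * c * q + q * s := by rw [h, zero_add]
    _ = q * (c * q + s) := by rw [mul_add, mul_assoc]
    _ = q := by rw [hcs, mul_one]
  exact hq (hqs ▸ m.smul_mem q hs)

theorem length_restrictScalars_eq_of_forall_isSimpleModule {K : Type*} {A : Type*} [CommRing K]
    [Ring A] [Algebra K A]
    (h : ∀ (S : Type x) [AddCommGroup S] [Module A S] [Module K S] [IsScalarTower K A S]
      [IsSimpleModule A S], Module.length K S = 1)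
    {M : Type x} [AddCommGroup M] [Module A M] (hM : IsFiniteLength A M) :
    ∀ [Module K M] [IsScalarTower K A M], Module.length K M = Module.length A M := by
  induction hM with
  | of_subsingleton => intros; simp
  | @of_simple_quotient M _ _ N _ _ ih =>
    intros
    rw [Module.length_eq_add_of_exact (N.subtype.restrictScalars K) (N.mkQ.restrictScalars K)
        N.injective_subtype N.mkQ_surjective (LinearMap.exact_subtype_mkQ N), ih, h,
      Module.length_eq_add_of_exact N.subtype N.mkQ N.injective_subtype N.mkQ_surjective
        (LinearMap.exact_subtype_mkQ N), Module.length_eq_one A (M ⧸ N)]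

variable {K : Type u} {Γ : Type v} [Field K] [Quiver.{w} Γ] [DecidableEq Γ] [Fintype Γ]
  {I : TwoSidedIdeal (PathAlgebra K Γ)}

namespace IsTriangularQuiver

variable (hΓ : IsTriangularQuiver Γ)
include hΓ

theorem pathClass_mem_jacobson (I : TwoSidedIdeal (PathAlgebra K Γ)) {a b : Γ} (q : Path a b)
    (hab : a ≠ b) : pathClass I q ∈ Ring.jacobson (BoundQuiverAlgebra I) := by
  refine mem_jacobson_of_forall_mul_mul_self_eq_zero fun c => ?_
  induction c using BoundQuiverAlgebra.induction_on with
  | zero => rw [mul_zero, zero_mul]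
  | add c d hc hd => rw [mul_add, add_mul, hc, hd, add_zero]
  | @smul_pathClass k x y r =>
    rw [mul_smul_comm, smul_mul_assoc]
    by_cases hx : b = x
    · by_cases hy : y = a
      · subst hx hy
        exact absurd (hΓ.eq_of_path_of_path q r) hab
      · rw [pathClass_mul_of_ne q r hy, zero_mul, smul_zero]
    · rw [mul_assoc, pathClass_mul_of_ne r q hx, mul_zero, smul_zero]

theorem exists_nil_mul_mul_nil_eq (v : Γ) (c : BoundQuiverAlgebra I) :
    ∃ k : K, pathClass I (Path.nil : Path v v) * c * pathClass I (Path.nil : Path v v)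
      = k • pathClass I (Path.nil : Path v v) := by
  induction c using BoundQuiverAlgebra.induction_on with
  | zero => exact ⟨0, by rw [mul_zero, zero_mul, zero_smul]⟩
  | add c d hc hd =>
    obtain ⟨k, hk⟩ := hc
    obtain ⟨l, hl⟩ := hd
    exact ⟨k + l, by rw [mul_add, add_mul, hk, hl, add_smul]⟩
  | @smul_pathClass k x y r =>
    rw [mul_smul_comm, smul_mul_assoc]
    by_cases hx : v = x
    · by_cases hy : y = v
      · subst hx hy
        obtain rfl := hΓ _ r
        exact ⟨k, by simp only [pathClass_mul, Path.nil_comp]⟩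
      · exact ⟨0, by rw [pathClass_mul_of_ne _ r hy, zero_mul, smul_zero, zero_smul]⟩
    · exact ⟨0, by rw [mul_assoc, pathClass_mul_of_ne r _ hx, mul_zero, smul_zero, zero_smul]⟩

section Modules

variable {M : Type x} [AddCommGroup M] [Module (BoundQuiverAlgebra I) M] [Module K M]
  [IsScalarTower K (BoundQuiverAlgebra I) M]

theorem exists_smul_eq_smul_of_isSimpleModule [IsSimpleModule (BoundQuiverAlgebra I) M] {v : Γ}
    {y : M} (hy : pathClass I (Path.nil : Path v v) • y = y) (c : BoundQuiverAlgebra I) :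
    ∃ k : K, c • y = k • y := by
  induction c using BoundQuiverAlgebra.induction_on with
  | zero => exact ⟨0, by rw [zero_smul, zero_smul]⟩
  | add c d hc hd =>
    obtain ⟨k, hk⟩ := hc
    obtain ⟨l, hl⟩ := hd
    exact ⟨k + l, by rw [add_smul, add_smul, hk, hl]⟩
  | @smul_pathClass k s t q =>
    by_cases hst : s = t
    · subst hst
      obtain rfl := hΓ _ q
      by_cases hs : s = v
      · subst hs
        exact ⟨k, by rw [smul_assoc, hy]⟩
      · refine ⟨0, ?_⟩
        rw [← hy, ← mul_smul, smul_mul_assoc, pathClass_mul_of_ne _ _ (Ne.symm hs), smul_zero,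
          zero_smul, zero_smul]
    · have hq : pathClass I q • y = 0 := Module.mem_annihilator.1
        (IsSemisimpleModule.jacobson_le_annihilator _ _ (hΓ.pathClass_mem_jacobson I q hst)) y
      exact ⟨0, by rw [smul_assoc, hq, smul_zero, zero_smul]⟩

theorem length_eq_one_of_isSimpleModule [IsSimpleModule (BoundQuiverAlgebra I) M] :
    Module.length K M = 1 := by
  have := IsSimpleModule.nontrivial (BoundQuiverAlgebra I) M
  obtain ⟨m, hm⟩ := exists_ne (0 : M)
  obtain ⟨v, hv⟩ : ∃ v : Γ, pathClass I (Path.nil : Path v v) • m ≠ 0 := by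
    by_contra! h
    refine hm ?_
    rw [← one_smul (BoundQuiverAlgebra I) m, ← sum_pathClass_nil I, Finset.sum_smul]
    exact Finset.sum_eq_zero fun v _ => h v
  rw [Module.length_eq_one_iff, isSimpleModule_iff_finrank_eq_one]
  refine finrank_eq_one _ hv fun y => ?_
  obtain ⟨c, rfl⟩ := IsSimpleModule.toSpanSingleton_surjective (BoundQuiverAlgebra I) hv y
  have hy : pathClass I (Path.nil : Path v v) • pathClass I (Path.nil : Path v v) • m
      = pathClass I (Path.nil : Path v v) • m := by rw [← mul_smul, pathClass_mul, Path.comp_nil]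
  obtain ⟨k, hk⟩ := hΓ.exists_smul_eq_smul_of_isSimpleModule (K := K) hy c
  exact ⟨k, hk.symm⟩

theorem length_eq (hM : IsFiniteLength (BoundQuiverAlgebra I) M) :
    Module.length K M = Module.length (BoundQuiverAlgebra I) M :=
  length_restrictScalars_eq_of_forall_isSimpleModule
    (fun _ => hΓ.length_eq_one_of_isSimpleModule (I := I)) hM

end Modules

end IsTriangularQuiver

end Radical

section Subpaths

variable {K : Type u} {Γ : Type v} [Field K] [Quiver.{w} Γ] [DecidableEq Γ] [Fintype Γ]
  (I : TwoSidedIdeal (PathAlgebra K Γ)) {a b : Γ} (p : Path a b)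

open Classical in
/-- The class of the right subpath of `p` ending in `v` (unique in a quiver without oriented
cycles), and zero if `v` is not on `p`, so that the vertices off `p` need no separate treatment. -/
noncomputable def rightSubpathClass (v : Γ) : BoundQuiverAlgebra I :=
  if h : ∃ u : Path a v, IsRightSubpath u p then pathClass I h.choose else 0

open Classical in
/-- The class of the left subpath of `p` starting in `v` (unique in a quiver without oriented
cycles), and zero if `v` is not on `p`. -/
noncomputable def leftSubpathClass (v : Γ) : BoundQuiverAlgebra I :=
  if h : ∃ r : Path v b, IsLeftSubpath r p then pathClass I h.choose else 0

/-- Condition (a) of the theorem, for the arrows of `B` and `D` at once: following `p` and then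
leaving it before its end is zero in `Λ`. -/
def RightDeviationsVanish : Prop :=
  ∀ ⦃x y : Γ⦄ (ε : x ⟶ y), x ≠ b → ¬ IsArrowOf ε p →
    arrowClass I ε * rightSubpathClass I p x = 0

/-- Condition (b) of the theorem, for the arrows of `C` and `D` at once: entering `p` after its
start, following it to its end and then continuing by `β` is zero in `Λ` whenever `β p ≠ 0`. -/
def LeftDeviationsVanish : Prop :=
  ∀ ⦃t : Γ⦄ (β : b ⟶ t), arrowClass I β * pathClass I p ≠ 0 →
    ∀ ⦃x y : Γ⦄ (ε : x ⟶ y), y ≠ a → ¬ IsArrowOf ε p →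
      arrowClass I β * leftSubpathClass I p y * arrowClass I ε = 0

variable {p}

theorem rightSubpathClass_of_notMem {v : Γ} (hv : v ∉ p.vertices) :
    rightSubpathClass I p v = 0 :=
  dif_neg fun ⟨_, hu⟩ => hv hu.target_mem

theorem leftSubpathClass_of_notMem {v : Γ} (hv : v ∉ p.vertices) :
    leftSubpathClass I p v = 0 :=
  dif_neg fun ⟨_, hr⟩ => hv hr.source_mem

theorem pathClass_mul_rightSubpathClass_of_ne {v c d : Γ} (q : Path c d) (h : v ≠ c) :
    pathClass I q * rightSubpathClass I p v = 0 := by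
  rw [rightSubpathClass]
  split_ifs
  · exact pathClass_mul_of_ne _ _ h
  · exact mul_zero _

theorem nil_mul_rightSubpathClass (v : Γ) :
    pathClass I (Path.nil : Path v v) * rightSubpathClass I p v = rightSubpathClass I p v := by
  rw [rightSubpathClass]
  split_ifs
  · rw [pathClass_mul, Path.comp_nil]
  · exact mul_zero _

theorem rightSubpathClass_mul_nil (v : Γ) :
    rightSubpathClass I p v * pathClass I (Path.nil : Path a a) = rightSubpathClass I p v := by
  rw [rightSubpathClass]
  split_ifs
  · rw [pathClass_mul, Path.nil_comp]
  · exact zero_mul _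

theorem leftSubpathClass_mul_pathClass_of_ne {v c d : Γ} (q : Path c d) (h : d ≠ v) :
    leftSubpathClass I p v * pathClass I q = 0 := by
  rw [leftSubpathClass]
  split_ifs
  · exact pathClass_mul_of_ne _ _ h
  · exact zero_mul _

theorem leftSubpathClass_mul_nil (v : Γ) :
    leftSubpathClass I p v * pathClass I (Path.nil : Path v v) = leftSubpathClass I p v := by
  rw [leftSubpathClass]
  split_ifs
  · rw [pathClass_mul, Path.nil_comp]
  · exact zero_mul _

variable (hΓ : IsTriangularQuiver Γ)
include hΓ

theorem IsRightSubpath.rightSubpathClass_eq {v : Γ} {u : Path a v} (hu : IsRightSubpath u p) :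
    rightSubpathClass I p v = pathClass I u := by
  have hv : ∃ u : Path a v, IsRightSubpath u p := ⟨u, hu⟩
  obtain ⟨r, hr⟩ := hu
  obtain ⟨r', hr'⟩ := hv.choose_spec
  rw [rightSubpathClass, dif_pos hv, (hΓ.split_unique (hr'.symm.trans hr)).1]

theorem IsLeftSubpath.leftSubpathClass_eq {v : Γ} {r : Path v b} (hr : IsLeftSubpath r p) :
    leftSubpathClass I p v = pathClass I r := by
  have hv : ∃ r : Path v b, IsLeftSubpath r p := ⟨r, hr⟩
  obtain ⟨u, hu⟩ := hr
  obtain ⟨u', hu'⟩ := hv.choose_spec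
  rw [leftSubpathClass, dif_pos hv, (hΓ.split_unique (hu'.symm.trans hu)).2]

theorem rightSubpathClass_source (p : Path a b) :
    rightSubpathClass I p a = pathClass I (Path.nil : Path a a) :=
  IsRightSubpath.rightSubpathClass_eq I hΓ ⟨p, p.nil_comp.symm⟩

theorem rightSubpathClass_target (p : Path a b) : rightSubpathClass I p b = pathClass I p :=
  IsRightSubpath.rightSubpathClass_eq I hΓ ⟨Path.nil, p.comp_nil.symm⟩

theorem leftSubpathClass_source (p : Path a b) : leftSubpathClass I p a = pathClass I p :=
  IsLeftSubpath.leftSubpathClass_eq I hΓ ⟨Path.nil, p.nil_comp.symm⟩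

theorem leftSubpathClass_mul_rightSubpathClass {v : Γ} (hv : v ∈ p.vertices) :
    leftSubpathClass I p v * rightSubpathClass I p v = pathClass I p := by
  obtain ⟨u, r, hp⟩ := p.exists_eq_comp_of_mem_vertices hv
  rw [IsLeftSubpath.leftSubpathClass_eq I hΓ ⟨u, hp⟩,
    IsRightSubpath.rightSubpathClass_eq I hΓ ⟨r, hp⟩, pathClass_mul, ← hp]

theorem IsArrowOf.arrowClass_mul_rightSubpathClass {x y : Γ} {α : x ⟶ y}
    (hα : IsArrowOf α p) :
    arrowClass I α * rightSubpathClass I p x = rightSubpathClass I p y := by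
  obtain ⟨u, r, hp⟩ := hα
  have hu : IsRightSubpath u p :=
    ⟨α.toPath.comp r, by rw [hp, ← Path.comp_assoc, Path.comp_toPath_eq_cons]⟩
  rw [IsRightSubpath.rightSubpathClass_eq I hΓ ⟨r, hp⟩, hu.rightSubpathClass_eq I hΓ,
    arrowClass_mul_pathClass]

theorem IsArrowOf.leftSubpathClass_mul_arrowClass {x y : Γ} {α : x ⟶ y}
    (hα : IsArrowOf α p) :
    leftSubpathClass I p y * arrowClass I α = leftSubpathClass I p x := by
  obtain ⟨u, r, hp⟩ := hα
  have hr : IsLeftSubpath (α.toPath.comp r) p :=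
    ⟨u, by rw [hp, ← Path.comp_assoc, Path.comp_toPath_eq_cons]⟩
  rw [IsLeftSubpath.leftSubpathClass_eq I hΓ ⟨_, hp⟩, hr.leftSubpathClass_eq I hΓ,
    pathClass_mul_arrowClass]

theorem rightSubpathClass_mem_jacobson {v : Γ} (hv : a ≠ v) :
    rightSubpathClass I p v ∈ Ring.jacobson (BoundQuiverAlgebra I) := by
  rw [rightSubpathClass]
  split_ifs
  · exact hΓ.pathClass_mem_jacobson I _ hv
  · exact zero_mem _

theorem rightDeviationsVanish_iff :
    RightDeviationsVanish I p ↔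
      (∀ (x y : Γ) (β : x ⟶ y), IsB p β →
        ∀ u : Path a x, IsRightSubpath u p → arrowClass I β * pathClass I u = 0) ∧
      (∀ (x y : Γ) (δ : x ⟶ y), IsD p δ →
        ∀ u : Path a x, IsRightSubpath u p → arrowClass I δ * pathClass I u = 0) := by
  constructor
  · refine fun h => ⟨fun x y β hβ u hu => ?_, fun x y δ hδ u hu => ?_⟩
    · rw [← hu.rightSubpathClass_eq I hΓ]
      exact h β hβ.2.1 fun hβp => hβ.2.2 hβp.target_mem
    · rw [← hu.rightSubpathClass_eq I hΓ]
      refine h δ ?_ hδ.2.2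
      rintro rfl
      exact hΓ.notMem_vertices_of_hom δ hδ.2.1
  · rintro ⟨hB, hD⟩ x y ε hx hε
    by_cases hxp : x ∈ p.vertices
    · obtain ⟨u, r, hp⟩ := p.exists_eq_comp_of_mem_vertices hxp
      have hu : IsRightSubpath u p := ⟨r, hp⟩
      rw [hu.rightSubpathClass_eq I hΓ]
      by_cases hyp : y ∈ p.vertices
      · exact hD x y ε ⟨hxp, hyp, hε⟩ u hu
      · exact hB x y ε ⟨hxp, hx, hyp⟩ u hu
    · rw [rightSubpathClass_of_notMem I hxp, mul_zero]

theorem leftDeviationsVanish_iff :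
    LeftDeviationsVanish I p ↔
      ∀ (z t : Γ) (β' : z ⟶ t), IsB' p β' → arrowClass I β' * pathClass I p ≠ 0 →
        (∀ (x y : Γ) (γ : x ⟶ y), IsC p γ → ∀ r : Path y b, IsLeftSubpath r p →
          arrowClass I β' * pathClass I r * arrowClass I γ = 0) ∧
        (∀ (x y : Γ) (δ : x ⟶ y), IsD p δ → ∀ r : Path y b, IsLeftSubpath r p →
          arrowClass I β' * pathClass I r * arrowClass I δ = 0) := by
  constructor
  · intro h z t β hz hβ
    obtain rfl : z = b := hz
    refine ⟨fun x y γ hγ r hr => ?_, fun x y δ hδ r hr => ?_⟩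
    · rw [← hr.leftSubpathClass_eq I hΓ]
      exact h β hβ γ hγ.2.2 fun hγp => hγ.1 hγp.source_mem
    · rw [← hr.leftSubpathClass_eq I hΓ]
      exact h β hβ δ (hΓ.target_ne_of_source_mem δ hδ.1) hδ.2.2
  · intro h t β hβ x y ε hy hε
    by_cases hyp : y ∈ p.vertices
    · obtain ⟨u, r, hp⟩ := p.exists_eq_comp_of_mem_vertices hyp
      have hr : IsLeftSubpath r p := ⟨u, hp⟩
      rw [hr.leftSubpathClass_eq I hΓ]
      by_cases hxp : x ∈ p.vertices
      · exact (h b t β rfl hβ).2 x y ε ⟨hxp, hyp, hε⟩ r hr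
      · exact (h b t β rfl hβ).1 x y ε ⟨hxp, hyp, hy⟩ r hr
    · rw [leftSubpathClass_of_notMem I hyp, mul_zero, zero_mul]

end Subpaths

section Mast

variable {K : Type u} {Γ : Type v} [Field K] [Quiver.{w} Γ] [DecidableEq Γ] [Fintype Γ]
  {I : TwoSidedIdeal (PathAlgebra K Γ)} {a b : Γ} {p : Path a b}
  {U : Type x} [AddCommGroup U] [Module (BoundQuiverAlgebra I) U] {x₀ : U}

theorem sum_pathClass_nil_smul (y : U) : ∑ v : Γ, pathClass I (Path.nil : Path v v) • y = y := by
  rw [← Finset.sum_smul, sum_pathClass_nil, one_smul]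

variable (I) in
theorem IsTriangularQuiver.pathClass_smul_mem_radSubmodule (hΓ : IsTriangularQuiver Γ)
    (p : Path a b) (hab : a ≠ b) (y : U) :
    pathClass I p • y ∈ radSubmodule (BoundQuiverAlgebra I) U :=
  Submodule.smul_mem_smul (hΓ.pathClass_mem_jacobson I p hab) Submodule.mem_top

variable (I p) in
/-- A top element of a module with mast `p : a → b`: an element concentrated at the vertex `a`
which is not annihilated by `p`. -/
structure IsTopElement (x₀ : U) : Prop where
  nil_smul : pathClass I (Path.nil : Path a a) • x₀ = x₀
  pathClass_smul_ne_zero : pathClass I p • x₀ ≠ 0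

namespace IsMast

variable (hp : IsMast I U p)
include hp

theorem exists_isTopElement : ∃ x₀ : U, IsTopElement I p x₀ := by
  obtain ⟨-, x, hx⟩ := hp
  refine ⟨pathClass I (Path.nil : Path a a) • x, ⟨?_, ?_⟩⟩
  · rw [← mul_smul, pathClass_mul, Path.nil_comp]
  · rwa [← mul_smul, pathClass_mul, Path.nil_comp]

theorem isFiniteLength : IsFiniteLength (BoundQuiverAlgebra I) U := by
  rw [← Module.length_ne_top_iff, hp.1]
  exact ENat.natCast_ne_top (p.length + 1)

theorem isNoetherian : IsNoetherian (BoundQuiverAlgebra I) U :=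
  (isFiniteLength_iff_isNoetherian_isArtinian.1 hp.isFiniteLength).1

theorem isSimpleModule_iff (hΓ : IsTriangularQuiver Γ) :
    IsSimpleModule (BoundQuiverAlgebra I) U ↔ a = b := by
  rw [← Module.length_eq_one_iff (R := BoundQuiverAlgebra I), hp.1]
  constructor
  · intro h
    have hlength : p.length + 1 = 1 := by exact_mod_cast h
    exact p.eq_of_length_zero (Nat.succ.inj hlength)
  · rintro rfl
    rw [hΓ a p, Path.length_nil, Nat.cast_zero, zero_add]

theorem finrank_eq [Module K U] [IsScalarTower K (BoundQuiverAlgebra I) U]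
    (hΓ : IsTriangularQuiver Γ) : Module.finrank K U = p.length + 1 := by
  have hlength := hΓ.length_eq (K := K) hp.isFiniteLength
  rw [hp.1, Module.length_eq_rank] at hlength
  rw [Module.finrank, ← Cardinal.toNat_toENat, hlength]
  rfl

end IsMast

namespace IsTopElement

variable (hΓ : IsTriangularQuiver Γ) (hx₀ : IsTopElement I p x₀)
include hΓ hx₀

theorem rightSubpathClass_smul_ne_zero {v : Γ} (hv : v ∈ p.vertices) :
    rightSubpathClass I p v • x₀ ≠ 0 := by
  intro h
  apply hx₀.pathClass_smul_ne_zero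
  rw [← leftSubpathClass_mul_rightSubpathClass I hΓ hv, mul_smul, h, smul_zero]

variable [Module K U] [IsScalarTower K (BoundQuiverAlgebra I) U]

theorem linearIndependent_rightSubpathClass_smul :
    LinearIndependent K fun v : {v // v ∈ p.vertices} => rightSubpathClass I p v • x₀ := by
  rw [Fintype.linearIndependent_iff]
  intro g hg v
  have hgv := congrArg (pathClass I (Path.nil : Path (v : Γ) v) • ·) hg
  simp only [Finset.smul_sum, smul_zero] at hgv
  rw [Finset.sum_eq_single v] at hgv
  · rw [smul_comm, ← mul_smul, nil_mul_rightSubpathClass] at hgv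
    exact (smul_eq_zero.1 hgv).resolve_right (hx₀.rightSubpathClass_smul_ne_zero hΓ v.2)
  · intro w _ hw
    rw [smul_comm, ← mul_smul,
      pathClass_mul_rightSubpathClass_of_ne _ _ fun h => hw (Subtype.ext h), zero_smul, smul_zero]
  · simp

variable (hp : IsMast I U p)
include hp

theorem exists_eq_sum_smul (y : U) :
    ∃ k : Γ → K, y = ∑ v, k v • rightSubpathClass I p v • x₀ := by
  have : Nonempty {v // v ∈ p.vertices} := ⟨⟨a, p.start_mem_vertices⟩⟩
  have hcard : Fintype.card {v // v ∈ p.vertices} = Module.finrank K U := by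
    rw [hp.finrank_eq hΓ, ← Path.vertices_length, ← List.toFinset_card_of_nodup
      (hΓ.vertices_nodup p), Fintype.card_of_subtype]
    simp
  have hspan := (hx₀.linearIndependent_rightSubpathClass_smul
    hΓ).span_eq_top_of_card_eq_finrank hcard
  have hy : y ∈ Submodule.span K (Set.range fun v : Γ => rightSubpathClass I p v • x₀) := by
    refine Submodule.span_mono ?_ (hspan ▸ Submodule.mem_top)
    rintro _ ⟨v, rfl⟩
    exact ⟨v, rfl⟩
  obtain ⟨k, hk⟩ := (Submodule.mem_span_range_iff_exists_fun K).1 hy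
  exact ⟨k, hk.symm⟩

theorem exists_nil_smul_eq (v : Γ) (y : U) :
    ∃ k : K, pathClass I (Path.nil : Path v v) • y = k • rightSubpathClass I p v • x₀ := by
  obtain ⟨k, rfl⟩ := hx₀.exists_eq_sum_smul hΓ hp y
  refine ⟨k v, ?_⟩
  rw [Finset.smul_sum, Finset.sum_eq_single v]
  · rw [smul_comm, ← mul_smul (pathClass I _), nil_mul_rightSubpathClass]
  · intro w _ hw
    rw [smul_comm, ← mul_smul (pathClass I _), pathClass_mul_rightSubpathClass_of_ne _ _ hw,
      zero_smul, smul_zero]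
  · simp

theorem exists_pathClass_smul_eq {v w : Γ} (q : Path v w) (y : U) :
    ∃ k : K, pathClass I q • y = k • rightSubpathClass I p w • x₀ := by
  obtain ⟨k, hk⟩ := hx₀.exists_nil_smul_eq hΓ hp w (pathClass I q • y)
  exact ⟨k, by rw [← hk, ← mul_smul, pathClass_mul, Path.comp_nil]⟩

theorem arrowClass_mul_pathClass_smul_eq_zero {w : Γ} (β : b ⟶ w) :
    (arrowClass I β * pathClass I p) • x₀ = 0 := by
  obtain ⟨k, hk⟩ := hx₀.exists_pathClass_smul_eq hΓ hp (p.cons β) x₀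
  rw [arrowClass_mul_pathClass, hk, rightSubpathClass_of_notMem I (hΓ.notMem_vertices_of_hom β),
    zero_smul, smul_zero]

theorem arrowClass_smul_eq_zero (hright : RightDeviationsVanish I p) {v w : Γ} (ε : v ⟶ w)
    (hε : ¬ IsArrowOf ε p) (y : U) : arrowClass I ε • y = 0 := by
  obtain ⟨k, hk⟩ := hx₀.exists_nil_smul_eq hΓ hp v y
  have hy : arrowClass I ε • y = k • (arrowClass I ε * rightSubpathClass I p v) • x₀ := by
    rw [mul_smul, smul_comm, ← hk, ← mul_smul, arrowClass, pathClass_mul, Path.nil_comp]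
  rw [hy]
  by_cases hv : v = b
  · subst hv
    rw [rightSubpathClass_target I hΓ, hx₀.arrowClass_mul_pathClass_smul_eq_zero hΓ hp, smul_zero]
  · rw [hright ε hv hε, zero_smul, smul_zero]

theorem span_singleton_eq_top : Submodule.span (BoundQuiverAlgebra I) {x₀} = ⊤ := by
  rw [eq_top_iff]
  rintro y -
  obtain ⟨k, rfl⟩ := hx₀.exists_eq_sum_smul hΓ hp y
  refine Submodule.sum_mem _ fun v _ => ?_
  rw [← algebraMap_smul (BoundQuiverAlgebra I), ← mul_smul]
  exact Submodule.smul_mem _ _ (Submodule.mem_span_singleton_self _)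

theorem radSubmodule_ne_top : radSubmodule (BoundQuiverAlgebra I) U ≠ ⊤ := by
  have : Nontrivial U := ⟨⟨_, _, hx₀.pathClass_smul_ne_zero⟩⟩
  have : Module.Finite (BoundQuiverAlgebra I) U :=
    ⟨{x₀}, by rw [Finset.coe_singleton, hx₀.span_singleton_eq_top hΓ hp]⟩
  exact (Submodule.jacobson_smul_lt_top ⊤).ne

theorem mem_radSubmodule_iff {y : U} :
    y ∈ radSubmodule (BoundQuiverAlgebra I) U ↔ pathClass I (Path.nil : Path a a) • y = 0 := by
  constructor
  · intro hy
    obtain ⟨k, hk⟩ := hx₀.exists_nil_smul_eq hΓ hp a y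
    rw [rightSubpathClass_source I hΓ, hx₀.nil_smul] at hk
    by_contra hne
    have hk0 : k ≠ 0 := by
      rintro rfl
      exact hne (hk.trans (zero_smul K x₀))
    refine hx₀.radSubmodule_ne_top hΓ hp (top_le_iff.1 ?_)
    rw [← hx₀.span_singleton_eq_top hΓ hp, Submodule.span_singleton_le_iff_mem,
      ← inv_smul_smul₀ hk0 x₀, ← hk, ← algebraMap_smul (BoundQuiverAlgebra I)]
    exact Submodule.smul_mem _ _ (Submodule.smul_mem _ _ hy)
  · intro hy
    rw [← sum_pathClass_nil_smul (I := I) y]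
    refine Submodule.sum_mem _ fun v _ => ?_
    by_cases hv : a = v
    · subst hv
      exact hy ▸ Submodule.zero_mem _
    · obtain ⟨k, hk⟩ := hx₀.exists_nil_smul_eq hΓ hp v y
      rw [hk, smul_comm]
      exact Submodule.smul_mem_smul (rightSubpathClass_mem_jacobson I hΓ hv) Submodule.mem_top

end IsTopElement

end Mast

section Necessity

namespace IsIrreducibleHom

section Ring

variable {R : Type u} [Ring R] {M N F : Type x} [AddCommGroup M] [Module R M] [AddCommGroup N]
  [Module R N] [AddCommGroup F] [Module R F] [Module.Finite R M] [Module.Finite R F]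

/- The map `f` factors through the pushout of `M` and `F` along `x` and `z`, that is, through the
quotient of `M × F` by `(x, -z)`. -/
theorem exists_map_eq_or_exists_lift {f : M →ₗ[R] N} (hf : IsIrreducibleHom f) {x : M} {z : F}
    {π : F →ₗ[R] N} (hπ : π z = f x) (y : N) :
    (∃ ρ : F →ₗ[R] M, ρ z = x) ∨
      ∃ (m : M) (t : F), f m + π t = y ∧ ∀ c : R, c • y = 0 → ∃ d : R, c • t = d • z := by
  let S : Submodule R (M × F) := Submodule.span R {(x, -z)}
  have hS : S ≤ LinearMap.ker (f.coprod π) := by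
    rw [Submodule.span_singleton_le_iff_mem, LinearMap.mem_ker, LinearMap.coprod_apply, map_neg,
      hπ, add_neg_cancel]
  have hfactor : S.liftQ (f.coprod π) hS ∘ₗ (S.mkQ ∘ₗ LinearMap.inl R M F) = f := by
    rw [← LinearMap.comp_assoc, S.liftQ_mkQ, LinearMap.coprod_inl]
  refine (hf.2.2 _ _ _ hfactor).imp ?_ ?_
  · rintro ⟨ρ, hρ⟩
    refine ⟨ρ ∘ₗ S.mkQ ∘ₗ LinearMap.inr R M F, ?_⟩
    have hxz : S.mkQ (LinearMap.inr R M F z) = S.mkQ (LinearMap.inl R M F x) := by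
      rw [eq_comm, ← sub_eq_zero, ← map_sub, Submodule.mkQ_apply, Submodule.Quotient.mk_eq_zero]
      refine Submodule.mem_span_singleton.2 ⟨1, ?_⟩
      simp
    rw [LinearMap.comp_apply, LinearMap.comp_apply, hxz]
    exact LinearMap.congr_fun hρ x
  · rintro ⟨σ, hσ⟩
    obtain ⟨⟨m, t⟩, hmt⟩ := S.mkQ_surjective (σ y)
    refine ⟨m, t, ?_, fun c hc => ?_⟩
    · have hy := LinearMap.congr_fun hσ y
      rwa [LinearMap.comp_apply, ← hmt, S.mkQ_apply, S.liftQ_apply, LinearMap.coprod_apply] at hy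
    · have hcS : c • (m, t) ∈ S := by
        rw [← Submodule.Quotient.mk_eq_zero, Submodule.Quotient.mk_smul, ← S.mkQ_apply, hmt,
          ← map_smul, hc, map_zero]
      obtain ⟨d, hd⟩ := Submodule.mem_span_singleton.1 hcS
      refine ⟨-d, ?_⟩
      rw [neg_smul, ← smul_neg]
      exact (congrArg Prod.snd hd).symm

end Ring

theorem not_isSimpleModule {R : Type u} [Ring R] {U : Type x} [AddCommGroup U] [Module R U]
    {N : Submodule R U} (hN : IsIrreducibleHom N.subtype) : ¬ IsSimpleModule R U := by
  intro hU
  obtain rfl | rfl := eq_bot_or_eq_top N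
  · exact hN.1 ⟨0, Subsingleton.elim _ _⟩
  · exact hN.2.1 ⟨LinearMap.id.codRestrict ⊤ fun _ => trivial, rfl⟩

theorem exists_annihilator_lift {R : Type u} [Ring R] {U : Type u} [AddCommGroup U] [Module R U]
    {N : Submodule R U} [Module.Finite R N] (hN : IsIrreducibleHom N.subtype) {q r : R}
    (hq : ∀ n ∈ N, q • n = 0) (hr : ∀ n ∈ N, r • n = 0) {y : U} (hqN : q • y ∈ N)
    (hqy : q • y ≠ 0) :
    ∃ n ∈ N, ∃ t s : R, n + t • y = y ∧
      ∀ c : R, c • y = 0 → ∃ d : R, c * t = d * q ∧ c * s = d * r := by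
  let π : R × R →ₗ[R] U := LinearMap.toSpanSingleton R U y ∘ₗ LinearMap.fst R R R
  obtain ⟨ρ, hρ⟩ | ⟨n, ⟨t, s⟩, hy, hlift⟩ :=
    hN.exists_map_eq_or_exists_lift (x := ⟨q • y, hqN⟩) (z := (q, r)) (π := π) rfl y
  · refine absurd ?_ hqy
    have hsplit : ((q, r) : R × R) = q • (1, 0) + r • (0, 1) := by simp
    have hq0 : q • ρ (1, 0) = 0 := Subtype.ext (hq _ (ρ (1, 0)).2)
    have hr0 : r • ρ (0, 1) = 0 := Subtype.ext (hr _ (ρ (0, 1)).2)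
    rw [hsplit, map_add, map_smul, map_smul, hq0, hr0, add_zero] at hρ
    exact congrArg Subtype.val hρ.symm
  · refine ⟨n, n.2, t, s, hy, fun c hc => ?_⟩
    obtain ⟨d, hd⟩ := hlift c hc
    exact ⟨d, congrArg Prod.fst hd, congrArg Prod.snd hd⟩

end IsIrreducibleHom

namespace IsMonomialIdeal

variable {K : Type u} {Γ : Type v} [Field K] [Quiver.{w} Γ] [DecidableEq Γ] [Fintype Γ]
  {I : TwoSidedIdeal (PathAlgebra K Γ)}

theorem pathCoeff_rightSubpathClass_eq_zero (hI : IsMonomialIdeal I) {a b v : Γ} {p : Path a b}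
    {q : Path a v} (hq : pathClass I q ≠ 0) (hqp : ¬ IsRightSubpath q p) :
    hI.pathCoeff hq (rightSubpathClass I p v) = 0 := by
  rw [rightSubpathClass]
  split_ifs with h
  · exact hI.pathCoeff_pathClass_of_ne hq fun heq => hqp (heq ▸ h.choose_spec)
  · exact map_zero _

end IsMonomialIdeal

variable {K : Type u} {Γ : Type v} [Field K] [Quiver.{w} Γ] [DecidableEq Γ] [Fintype Γ]
  {I : TwoSidedIdeal (PathAlgebra K Γ)} {a b : Γ} {p : Path a b}
  {U : Type (max u v w)} [AddCommGroup U] [Module (BoundQuiverAlgebra I) U] [Module K U]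
  [IsScalarTower K (BoundQuiverAlgebra I) U] {x₀ : U}
  (hΓ : IsTriangularQuiver Γ) (hp : IsMast I U p)
  (hirr : IsIrreducibleHom (radSubmodule (BoundQuiverAlgebra I) U).subtype)
include hΓ hp hirr

theorem IsTopElement.exists_eq_mul_pathClass (hx₀ : IsTopElement I p x₀)
    {r : BoundQuiverAlgebra I} (hr : ∀ y ∈ radSubmodule (BoundQuiverAlgebra I) U, r • y = 0) :
    ∃ s : BoundQuiverAlgebra I, ∀ c : BoundQuiverAlgebra I,
      c * pathClass I (Path.nil : Path a a) = c → c • x₀ = 0 →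
        ∃ d, c = d * pathClass I p ∧ c * s = d * r := by
  have := hp.isNoetherian
  have hab : a ≠ b := fun h => hirr.not_isSimpleModule ((hp.isSimpleModule_iff hΓ).2 h)
  have hpN := hΓ.pathClass_smul_mem_radSubmodule I p hab x₀
  have hpkill : ∀ y ∈ radSubmodule (BoundQuiverAlgebra I) U, pathClass I p • y = 0 := by
    intro y hy
    rw [← p.nil_comp, ← pathClass_mul, mul_smul, (hx₀.mem_radSubmodule_iff hΓ hp).1 hy, smul_zero]
  obtain ⟨n, hn, t, s, hy, hlift⟩ :=
    hirr.exists_annihilator_lift hpkill hr hpN hx₀.pathClass_smul_ne_zero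
  obtain ⟨k, hk⟩ := hΓ.exists_nil_mul_mul_nil_eq a t
  have hk1 : k = 1 := by
    have htop : (1 : K) • x₀ = k • x₀ := calc
      (1 : K) • x₀ = pathClass I Path.nil • (n + t • x₀) := by rw [hy, hx₀.nil_smul, one_smul]
      _ = pathClass I Path.nil • t • pathClass I (Path.nil : Path a a) • x₀ := by
        rw [smul_add, (hx₀.mem_radSubmodule_iff hΓ hp).1 hn, zero_add, hx₀.nil_smul]
      _ = k • x₀ := by rw [← mul_smul, ← mul_smul, hk, smul_assoc, hx₀.nil_smul]
    refine (smul_left_injective K ?_ htop).symm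
    rintro rfl
    exact hx₀.pathClass_smul_ne_zero (smul_zero _)
  rw [hk1, one_smul] at hk
  refine ⟨s, fun c hc hcx => ?_⟩
  obtain ⟨d, hd, hds⟩ := hlift c hcx
  refine ⟨d, ?_, hds⟩
  calc c = c * (pathClass I Path.nil * t * pathClass I Path.nil) := by rw [hk, hc]
    _ = c * t * pathClass I Path.nil := by rw [mul_assoc, ← mul_assoc c, hc, mul_assoc]
    _ = d * pathClass I p := by rw [hd, mul_assoc, pathClass_mul, Path.nil_comp]

theorem rightDeviationsVanish_of_isIrreducibleHom (hmon : IsMonomialIdeal I) :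
    RightDeviationsVanish I p := by
  intro x y ε hxb hε
  by_contra hne
  by_cases hxp : x ∈ p.vertices
  swap
  · rw [rightSubpathClass_of_notMem I hxp, mul_zero] at hne
    exact hne rfl
  obtain ⟨u, t, hut⟩ := p.exists_eq_comp_of_mem_vertices hxp
  rw [IsRightSubpath.rightSubpathClass_eq I hΓ ⟨t, hut⟩, arrowClass_mul_pathClass] at hne
  have hεu : ¬ IsRightSubpath (u.cons ε) p := fun ⟨r, hr⟩ => hε ⟨u, r, hr⟩
  obtain ⟨x₀, hx₀⟩ := hp.exists_isTopElement
  obtain ⟨k, hk⟩ := hx₀.exists_pathClass_smul_eq hΓ hp (u.cons ε) x₀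
  obtain ⟨_, hs⟩ := hx₀.exists_eq_mul_pathClass hΓ hp hirr (r := 0) fun _ _ => zero_smul _ _
  obtain ⟨d, hd, -⟩ := hs (pathClass I (u.cons ε) - k • rightSubpathClass I p y)
    (by rw [sub_mul, smul_mul_assoc, rightSubpathClass_mul_nil, pathClass_mul, Path.nil_comp])
    (by rw [sub_smul, hk, smul_assoc, sub_self])
  obtain ⟨r, hr⟩ : IsRightSubpath p (u.cons ε) := by
    refine hmon.isRightSubpath_of_pathCoeff_mul_ne_zero (hq := hne) (d := d) ?_
    rw [← hd, map_sub, map_smul, hmon.pathCoeff_rightSubpathClass_eq_zero hne hεu,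
      hmon.pathCoeff_pathClass_self, smul_zero, sub_zero]
    exact one_ne_zero
  cases r with
  | nil => exact hεu ⟨Path.nil, hr.symm⟩
  | cons r α =>
    obtain rfl := Path.obj_eq_of_cons_eq_cons hr
    exact hxb (hΓ.eq_of_path_of_path t r)

theorem leftDeviationsVanish_of_isIrreducibleHom (hmon : IsMonomialIdeal I) :
    LeftDeviationsVanish I p := by
  intro t β hβ x y ε hya hε
  by_contra hne
  by_cases hyp : y ∈ p.vertices
  swap
  · rw [leftSubpathClass_of_notMem I hyp, mul_zero, zero_mul] at hne
    exact hne rfl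
  obtain ⟨u, r, hur⟩ := p.exists_eq_comp_of_mem_vertices hyp
  rw [IsLeftSubpath.leftSubpathClass_eq I hΓ ⟨u, hur⟩, mul_assoc, pathClass_mul_arrowClass,
    arrowClass_mul_pathClass] at hne
  have hβ0 : pathClass I β.toPath ≠ 0 := left_ne_zero_of_mul hβ
  rw [arrowClass_mul_pathClass] at hβ
  obtain ⟨x₀, hx₀⟩ := hp.exists_isTopElement
  have hright := rightDeviationsVanish_of_isIrreducibleHom hΓ hp hirr hmon
  obtain ⟨s, hs⟩ := hx₀.exists_eq_mul_pathClass hΓ hp hirr (r := pathClass I (ε.toPath.comp r))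
    fun m _ => by
      rw [← pathClass_mul_arrowClass, mul_smul, hx₀.arrowClass_smul_eq_zero hΓ hp hright ε hε,
        smul_zero]
  obtain ⟨d, hd, hds⟩ := hs (pathClass I (p.cons β)) (by rw [pathClass_mul, Path.nil_comp])
    (by rw [← arrowClass_mul_pathClass, hx₀.arrowClass_mul_pathClass_smul_eq_zero hΓ hp])
  have hdβ : hmon.pathCoeff hβ0 d = 1 := calc
    hmon.pathCoeff hβ0 d = hmon.pathCoeff hβ (d * pathClass I p) :=
      (hmon.pathCoeff_comp_mul_pathClass (q := β.toPath) hβ hβ0 d).symm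
    _ = 1 := by rw [← hd, hmon.pathCoeff_pathClass_self]
  obtain ⟨q, hq⟩ : IsLeftSubpath (p.cons β) ((ε.toPath.comp r).cons β) := by
    refine hmon.isLeftSubpath_of_pathCoeff_mul_ne_zero (hq := hne) (d := s) ?_
    rw [hds]
    refine ne_of_eq_of_ne ?_ one_ne_zero
    exact (hmon.pathCoeff_comp_mul_pathClass (q := β.toPath) hne hβ0 d).trans hdβ
  subst hur
  exact hε (hΓ.isArrowOf_of_isLeftSubpath_toPath_comp hya
    ⟨q, eq_of_heq (Path.heq_of_cons_eq_cons hq)⟩)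

end Necessity

section Sufficiency

theorem exists_linearMap_apply_eq_of_span_singleton_eq_top {R : Type*} [Ring R] {M N : Type*}
    [AddCommGroup M] [Module R M] [AddCommGroup N] [Module R N] {x : M} {y : N}
    (hx : Submodule.span R {x} = ⊤) (hxy : ∀ c : R, c • x = 0 → c • y = 0) :
    ∃ f : M →ₗ[R] N, f x = y := by
  let q : R →ₗ[R] M := LinearMap.toSpanSingleton R M x
  have hq : Function.Surjective q := by
    rw [← LinearMap.range_eq_top, LinearMap.range_toSpanSingleton, hx]
  let e : (R ⧸ LinearMap.ker q) ≃ₗ[R] M := q.quotKerEquivOfSurjective hq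
  have hker : LinearMap.ker q ≤ LinearMap.ker (LinearMap.toSpanSingleton R N y) := hxy
  refine ⟨(LinearMap.ker q).liftQ _ hker ∘ₗ e.symm, ?_⟩
  have he : e.symm x = (LinearMap.ker q).mkQ 1 := by
    rw [LinearEquiv.symm_apply_eq]
    exact (one_smul R x).symm
  rw [LinearMap.comp_apply, LinearEquiv.coe_coe, he, Submodule.mkQ_apply, Submodule.liftQ_apply,
    LinearMap.toSpanSingleton_apply, one_smul]

variable {K : Type u} {Γ : Type v} [Field K] [Quiver.{w} Γ] [DecidableEq Γ] [Fintype Γ]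
  {I : TwoSidedIdeal (PathAlgebra K Γ)} {a b : Γ} {p : Path a b}
  {V : Type x} [AddCommGroup V] [Module (BoundQuiverAlgebra I) V]
  [Module K V] [IsScalarTower K (BoundQuiverAlgebra I) V]

section Presentation

variable (hΓ : IsTriangularQuiver Γ) (hright : RightDeviationsVanish I p) {v₁ : V}
  (hv₁ : pathClass I (Path.nil : Path a a) • v₁ = v₁)
  (hβ : ∀ ⦃t : Γ⦄ (β : b ⟶ t), (arrowClass I β * pathClass I p) • v₁ = 0)
include hΓ hright hv₁ hβ

theorem exists_pathClass_smul_eq_smul_rightSubpathClass {v w : Γ} (q : Path v w) :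
    ∃ k : K, pathClass I q • v₁ = k • rightSubpathClass I p w • v₁ := by
  induction q with
  | nil =>
    by_cases hv : a = v
    · subst hv
      exact ⟨1, by rw [rightSubpathClass_source I hΓ, one_smul]⟩
    · exact ⟨0, by rw [← hv₁, ← mul_smul, pathClass_mul_of_ne _ _ hv, zero_smul, zero_smul]⟩
  | @cons x y q α ih =>
    obtain ⟨k, hk⟩ := ih
    rw [← arrowClass_mul_pathClass, mul_smul, hk, smul_comm, ← mul_smul]
    by_cases hα : IsArrowOf α p
    · exact ⟨k, by rw [hα.arrowClass_mul_rightSubpathClass I hΓ]⟩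
    · refine ⟨0, ?_⟩
      rw [zero_smul]
      by_cases hx : x = b
      · subst hx
        rw [rightSubpathClass_target I hΓ, hβ, smul_zero]
      · rw [hright α hx hα, zero_smul, smul_zero]

theorem exists_nil_smul_smul_eq_smul_rightSubpathClass (v : Γ) (c : BoundQuiverAlgebra I) :
    ∃ k : K, pathClass I (Path.nil : Path v v) • c • v₁
      = k • rightSubpathClass I p v • v₁ := by
  induction c using BoundQuiverAlgebra.induction_on with
  | zero => exact ⟨0, by rw [zero_smul, zero_smul, smul_zero]⟩
  | add c d hc hd =>
    obtain ⟨k, hk⟩ := hc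
    obtain ⟨l, hl⟩ := hd
    exact ⟨k + l, by rw [add_smul, smul_add, hk, hl, add_smul]⟩
  | @smul_pathClass k x y q =>
    by_cases hy : y = v
    · subst hy
      obtain ⟨l, hl⟩ :=
        exists_pathClass_smul_eq_smul_rightSubpathClass hΓ hright hv₁ hβ q
      exact ⟨k * l, by rw [smul_assoc, smul_comm, ← mul_smul (pathClass I _), pathClass_mul,
        Path.comp_nil, hl, mul_smul]⟩
    · exact ⟨0, by rw [smul_assoc, smul_comm, ← mul_smul (pathClass I _),
        pathClass_mul_of_ne _ _ hy, zero_smul, smul_zero, zero_smul]⟩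

end Presentation

variable {U : Type x} [AddCommGroup U] [Module (BoundQuiverAlgebra I) U]
  [Module K U] [IsScalarTower K (BoundQuiverAlgebra I) U] {x₀ : U}

namespace IsTopElement

variable (hΓ : IsTriangularQuiver Γ) (hx₀ : IsTopElement I p x₀) (hp : IsMast I U p)
  (hright : RightDeviationsVanish I p)
include hΓ hx₀ hp hright

theorem smul_eq_zero_of_smul_eq_zero {v₁ : V}
    (hv₁ : pathClass I (Path.nil : Path a a) • v₁ = v₁)
    (hβ : ∀ ⦃t : Γ⦄ (β : b ⟶ t), (arrowClass I β * pathClass I p) • v₁ = 0)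
    {c : BoundQuiverAlgebra I} (hc : c • x₀ = 0) : c • v₁ = 0 := by
  rw [← sum_pathClass_nil_smul (I := I) (c • v₁)]
  refine Finset.sum_eq_zero fun v _ => ?_
  obtain ⟨k, hk⟩ := exists_nil_smul_smul_eq_smul_rightSubpathClass (v₁ := (x₀, v₁)) hΓ hright
    (Prod.ext hx₀.nil_smul hv₁)
    (fun t β => Prod.ext (hx₀.arrowClass_mul_pathClass_smul_eq_zero hΓ hp β) (hβ β)) v c
  have hkx : k • rightSubpathClass I p v • x₀ = 0 := by
    rw [← smul_zero (pathClass I (Path.nil : Path v v)), ← hc]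
    exact (congrArg Prod.fst hk).symm
  refine (congrArg Prod.snd hk).trans ?_
  change k • rightSubpathClass I p v • v₁ = 0
  by_cases hv : v ∈ p.vertices
  · rw [(smul_eq_zero.1 hkx).resolve_right (hx₀.rightSubpathClass_smul_ne_zero hΓ hv), zero_smul]
  · rw [rightSubpathClass_of_notMem I hv, zero_smul, smul_zero]

theorem isSplitEpiHom_of_pathClass_smul_eq {h : V →ₗ[BoundQuiverAlgebra I] U} {y : V}
    (hy : pathClass I p • h y = pathClass I p • x₀)
    (hβ : ∀ ⦃t : Γ⦄ (β : b ⟶ t), (arrowClass I β * pathClass I p) • y = 0) :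
    IsSplitEpiHom h := by
  have hpe : pathClass I p * pathClass I (Path.nil : Path a a) = pathClass I p := by
    rw [pathClass_mul, Path.nil_comp]
  obtain ⟨σ, hσ⟩ := exists_linearMap_apply_eq_of_span_singleton_eq_top
    (hx₀.span_singleton_eq_top hΓ hp) (y := pathClass I (Path.nil : Path a a) • y)
    fun c hc => hx₀.smul_eq_zero_of_smul_eq_zero hΓ hp hright
      (by rw [← mul_smul, pathClass_mul, Path.nil_comp])
      (fun t β => by rw [← mul_smul, mul_assoc, hpe, hβ]) hc
  have hx : h (σ x₀) = x₀ := by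
    obtain ⟨k, hk⟩ := hx₀.exists_nil_smul_eq hΓ hp a (h y)
    rw [rightSubpathClass_source I hΓ, hx₀.nil_smul] at hk
    have hk1 : k • pathClass I p • x₀ = (1 : K) • pathClass I p • x₀ := by
      rw [one_smul, smul_comm, ← hk, ← mul_smul, hpe, hy]
    rw [hσ, map_smul, hk, smul_left_injective K hx₀.pathClass_smul_ne_zero hk1, one_smul]
  refine ⟨σ, LinearMap.ext_on (hx₀.span_singleton_eq_top hΓ hp) ?_⟩
  rintro _ rfl
  exact hx

end IsTopElement

section MastMap

theorem leftSubpathClass_mul_rightSubpathClass_of_ne {v w : Γ} (h : w ≠ v) :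
    leftSubpathClass I p v * rightSubpathClass I p w = 0 := by
  rw [← leftSubpathClass_mul_nil, mul_assoc, pathClass_mul_rightSubpathClass_of_ne I _ h, mul_zero]

variable (φ : V →ₗ[K] K)

variable (I p x₀) in
/-- The `K`-linear map `m ↦ ∑ᵥ φ (rᵥ m) uᵥ x₀` given by a functional `φ`, where `p = rᵥ uᵥ` is the
factorization of `p` at its vertex `v`. It is the candidate for a retraction onto `JU`. -/
noncomputable def mastMap : V →ₗ[K] U :=
  ∑ v : Γ, (φ ∘ₗ DistribSMul.toLinearMap K V (leftSubpathClass I p v)).smulRight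
    (rightSubpathClass I p v • x₀)

omit [IsScalarTower K (BoundQuiverAlgebra I) U] in
theorem mastMap_apply (m : V) :
    mastMap I p x₀ φ m =
      ∑ v : Γ, φ (leftSubpathClass I p v • m) • rightSubpathClass I p v • x₀ := by
  rw [mastMap, LinearMap.sum_apply]
  rfl

omit [IsScalarTower K (BoundQuiverAlgebra I) U] in
theorem mastMap_pathClass_smul {v w : Γ} (q : Path v w) (m : V) :
    mastMap I p x₀ φ (pathClass I q • m) =
      φ ((leftSubpathClass I p w * pathClass I q) • m) • rightSubpathClass I p w • x₀ := by
  rw [mastMap_apply, Finset.sum_eq_single w]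
  · rw [mul_smul]
  · intro v _ hv
    rw [← mul_smul, leftSubpathClass_mul_pathClass_of_ne I q hv.symm, zero_smul, map_zero,
      zero_smul]
  · simp

theorem pathClass_smul_mastMap {v w : Γ} (q : Path v w) (m : V) :
    pathClass I q • mastMap I p x₀ φ m =
      φ (leftSubpathClass I p v • m) • (pathClass I q * rightSubpathClass I p v) • x₀ := by
  rw [mastMap_apply, Finset.smul_sum, Finset.sum_eq_single v]
  · rw [smul_comm, mul_smul]
  · intro w _ hw
    rw [smul_comm, ← mul_smul, pathClass_mul_rightSubpathClass_of_ne I q hw, zero_smul, smul_zero]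
  · simp

theorem map_smul_of_map_arrowClass_smul (f : V →ₗ[K] U)
    (hnil : ∀ (v : Γ) (m : V), f (pathClass I (Path.nil : Path v v) • m)
      = pathClass I (Path.nil : Path v v) • f m)
    (harrow : ∀ ⦃v w : Γ⦄ (α : v ⟶ w) (m : V), f (arrowClass I α • m) = arrowClass I α • f m)
    (c : BoundQuiverAlgebra I) (m : V) : f (c • m) = c • f m := by
  induction c using BoundQuiverAlgebra.induction_on with
  | zero => rw [zero_smul, zero_smul, map_zero]
  | add c d hc hd => rw [add_smul, map_add, hc, hd, add_smul]
  | smul_pathClass k q =>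
    rw [smul_assoc, map_smul, smul_assoc]
    congr 1
    induction q with
    | nil => exact hnil _ m
    | cons q α ih =>
      rw [← arrowClass_mul_pathClass, mul_smul, harrow, ih, mul_smul]

variable (I p V) in
/-- The `K`-subspace of `V` spanned by the elements `r ε m`, for the proper left subpaths `r` of
`p` and the arrows `ε` off `p` which `r` continues. -/
def deviationSubmodule : Submodule K V :=
  Submodule.span K {m | ∃ (x y : Γ) (ε : x ⟶ y) (m' : V), y ≠ a ∧ ¬ IsArrowOf ε p ∧
    (leftSubpathClass I p y * arrowClass I ε) • m' = m}

omit [IsScalarTower K (BoundQuiverAlgebra I) V] in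
theorem deviationSubmodule_le_ker_iff {W : Type*} [AddCommGroup W] [Module K W] {f : V →ₗ[K] W} :
    deviationSubmodule I p V ≤ LinearMap.ker f ↔
      ∀ ⦃x y : Γ⦄ (ε : x ⟶ y), y ≠ a → ¬ IsArrowOf ε p →
        ∀ m : V, f ((leftSubpathClass I p y * arrowClass I ε) • m) = 0 := by
  rw [deviationSubmodule, Submodule.span_le]
  constructor
  · exact fun h x y ε hy hε m => h ⟨x, y, ε, m, hy, hε, rfl⟩
  · rintro h _ ⟨x, y, ε, m, hy, hε, rfl⟩
    exact h ε hy hε m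

end MastMap

namespace IsTopElement

variable (hΓ : IsTriangularQuiver Γ) (hx₀ : IsTopElement I p x₀) (hp : IsMast I U p)
  (hright : RightDeviationsVanish I p) {φ : V →ₗ[K] K}
  (hφp : ∀ m, φ (pathClass I p • m) = 0) (hφ : deviationSubmodule I p V ≤ LinearMap.ker φ)

include hΓ hx₀ hp hright hφp hφ in
theorem mastMap_smul (c : BoundQuiverAlgebra I) (m : V) :
    mastMap I p x₀ φ (c • m) = c • mastMap I p x₀ φ m := by
  refine map_smul_of_map_arrowClass_smul _ (fun v m => ?_) (fun v w α m => ?_) c m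
  · rw [mastMap_pathClass_smul, pathClass_smul_mastMap, leftSubpathClass_mul_nil,
      nil_mul_rightSubpathClass]
  by_cases hα : IsArrowOf α p
  · rw [arrowClass, mastMap_pathClass_smul, pathClass_smul_mastMap, ← arrowClass,
      hα.leftSubpathClass_mul_arrowClass I hΓ, hα.arrowClass_mul_rightSubpathClass I hΓ]
  rw [hx₀.arrowClass_smul_eq_zero hΓ hp hright α hα, arrowClass, mastMap_pathClass_smul,
    ← arrowClass]
  by_cases hw : w = a
  · subst hw
    rw [leftSubpathClass_source I hΓ, mul_smul, hφp, zero_smul]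
  · rw [deviationSubmodule_le_ker_iff.1 hφ α hw hα, zero_smul]

include hΓ hx₀ hp hφp in
theorem mastMap_mem_radSubmodule (m : V) :
    mastMap I p x₀ φ m ∈ radSubmodule (BoundQuiverAlgebra I) U := by
  rw [hx₀.mem_radSubmodule_iff hΓ hp, pathClass_smul_mastMap, leftSubpathClass_source I hΓ, hφp,
    zero_smul]

include hΓ hx₀ hp hright hφp hφ in
theorem isSplitMonoHom_of_map_pathClass_smul_eq_one
    {g : radSubmodule (BoundQuiverAlgebra I) U →ₗ[BoundQuiverAlgebra I] V}
    {n₀ : radSubmodule (BoundQuiverAlgebra I) U} (hn₀ : (n₀ : U) = pathClass I p • x₀)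
    (hφg : φ (g n₀) = 1) : IsSplitMonoHom g := by
  let ρ : V →ₗ[BoundQuiverAlgebra I] U :=
    { toFun := mastMap I p x₀ φ
      map_add' := map_add _
      map_smul' := hx₀.mastMap_smul hΓ hp hright hφp hφ }
  refine ⟨ρ.codRestrict _ (hx₀.mastMap_mem_radSubmodule hΓ hp hφp), ?_⟩
  ext n
  change mastMap I p x₀ φ (g n) = n
  obtain ⟨k, hk⟩ := hx₀.exists_eq_sum_smul hΓ hp (n : U)
  rw [mastMap_apply]
  conv_rhs => rw [hk]
  refine Finset.sum_congr rfl fun v _ => ?_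
  by_cases hv : v ∈ p.vertices
  · have hvn : leftSubpathClass I p v • n = k v • n₀ := by
      refine Subtype.ext ?_
      rw [Submodule.coe_smul, Submodule.coe_smul_of_tower, hn₀, hk, Finset.smul_sum,
        Finset.sum_eq_single v]
      · rw [smul_comm, ← mul_smul, leftSubpathClass_mul_rightSubpathClass I hΓ hv]
      · intro w _ hw
        rw [smul_comm, ← mul_smul, leftSubpathClass_mul_rightSubpathClass_of_ne hw, zero_smul,
          smul_zero]
      · simp
    rw [← map_smul, hvn, g.map_smul_of_tower, map_smul, hφg, smul_eq_mul, mul_one]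
  · rw [rightSubpathClass_of_notMem I hv, zero_smul, smul_zero, smul_zero]

end IsTopElement

section Factorization

variable (hΓ : IsTriangularQuiver Γ) (hx₀ : IsTopElement I p x₀) (hp : IsMast I U p)
  (hright : RightDeviationsVanish I p)
include hΓ hx₀ hp hright

theorem deviationSubmodule_le_ker_of_linearMap (h : V →ₗ[BoundQuiverAlgebra I] U) :
    deviationSubmodule I p V ≤ LinearMap.ker (h.restrictScalars K) := by
  rw [deviationSubmodule_le_ker_iff]
  intro x y ε _ hε m
  rw [LinearMap.restrictScalars_apply, map_smul, mul_smul,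
    hx₀.arrowClass_smul_eq_zero hΓ hp hright ε hε, smul_zero]

omit hΓ hx₀ hp hright in
theorem deviationSubmodule_le_ker_arrowClass_smul (hleft : LeftDeviationsVanish I p) {t : Γ}
    {β : b ⟶ t} (hβ : arrowClass I β * pathClass I p ≠ 0) :
    deviationSubmodule I p V ≤ LinearMap.ker (DistribSMul.toLinearMap K V (arrowClass I β)) := by
  rw [deviationSubmodule_le_ker_iff]
  intro x y ε hy hε m
  rw [DistribSMul.toLinearMap_apply, ← mul_smul, ← mul_assoc, hleft β hβ ε hy hε, zero_smul]

variable (hleft : LeftDeviationsVanish I p)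
  {g : radSubmodule (BoundQuiverAlgebra I) U →ₗ[BoundQuiverAlgebra I] V}
  {h : V →ₗ[BoundQuiverAlgebra I] U}
  (hhg : h ∘ₗ g = (radSubmodule (BoundQuiverAlgebra I) U).subtype)
  {n₀ : radSubmodule (BoundQuiverAlgebra I) U} (hn₀ : (n₀ : U) = pathClass I p • x₀)
include hleft hhg hn₀

theorem isSplitEpiHom_of_mem_sup
    (hz : g n₀ ∈ LinearMap.range (DistribSMul.toLinearMap K V (pathClass I p)) ⊔
      deviationSubmodule I p V) :
    IsSplitEpiHom h := by
  obtain ⟨_, ⟨y, rfl⟩, m, hm, hym⟩ := Submodule.mem_sup.1 hz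
  rw [DistribSMul.toLinearMap_apply] at hym
  refine hx₀.isSplitEpiHom_of_pathClass_smul_eq hΓ hp hright (y := y) ?_ fun t β => ?_
  · have hhm : h m = 0 := deviationSubmodule_le_ker_of_linearMap hΓ hx₀ hp hright h hm
    rw [← hn₀, ← map_smul, ← add_zero (h _), ← hhm, ← map_add, hym]
    exact LinearMap.congr_fun hhg n₀
  · by_cases hβ : arrowClass I β * pathClass I p = 0
    · rw [hβ, zero_smul]
    have hβm : arrowClass I β • m = 0 := deviationSubmodule_le_ker_arrowClass_smul hleft hβ hm
    have hβn : arrowClass I β • n₀ = 0 := Subtype.ext <| by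
      rw [Submodule.coe_smul, hn₀, ← mul_smul, hx₀.arrowClass_mul_pathClass_smul_eq_zero hΓ hp,
        Submodule.coe_zero]
    rw [mul_smul, ← add_zero (arrowClass I β • pathClass I p • y), ← hβm, ← smul_add, hym,
      ← map_smul, hβn, map_zero, hβm]

theorem isSplitMonoHom_or_isSplitEpiHom : IsSplitMonoHom g ∨ IsSplitEpiHom h := by
  by_cases hz : g n₀ ∈ LinearMap.range (DistribSMul.toLinearMap K V (pathClass I p)) ⊔
    deviationSubmodule I p V
  · exact .inr (isSplitEpiHom_of_mem_sup hΓ hx₀ hp hright hleft hhg hn₀ hz)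
  obtain ⟨φ, hφz, hφ⟩ := Submodule.exists_le_ker_of_notMem hz
  obtain ⟨hφp, hφdev⟩ := sup_le_iff.1 hφ
  refine .inl (hx₀.isSplitMonoHom_of_map_pathClass_smul_eq_one hΓ hp hright
    (φ := (φ (g n₀))⁻¹ • φ) (fun m => ?_) (fun m hm => ?_) hn₀ (inv_mul_cancel₀ hφz))
  · exact (congrArg _ (hφp ⟨m, rfl⟩)).trans (mul_zero _)
  · exact (congrArg _ (hφdev hm)).trans (mul_zero _)

end Factorization

namespace IsTopElement

variable (hΓ : IsTriangularQuiver Γ) (hx₀ : IsTopElement I p x₀) (hp : IsMast I U p)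
include hΓ hx₀ hp

theorem not_isSplitMonoHom_radSubmodule_subtype (hab : a ≠ b) :
    ¬ IsSplitMonoHom (radSubmodule (BoundQuiverAlgebra I) U).subtype := by
  rintro ⟨ρ, hρ⟩
  have hρx : ρ x₀ = 0 := by
    rw [← hx₀.nil_smul, map_smul]
    exact Subtype.ext ((hx₀.mem_radSubmodule_iff hΓ hp).1 (ρ x₀).2)
  have hpx := hΓ.pathClass_smul_mem_radSubmodule I p hab x₀
  have hρp : ρ (pathClass I p • x₀) = ⟨_, hpx⟩ := LinearMap.congr_fun hρ ⟨_, hpx⟩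
  rw [map_smul, hρx, smul_zero] at hρp
  exact hx₀.pathClass_smul_ne_zero (congrArg Subtype.val hρp).symm

theorem not_isSplitEpiHom_radSubmodule_subtype :
    ¬ IsSplitEpiHom (radSubmodule (BoundQuiverAlgebra I) U).subtype := by
  rintro ⟨σ, hσ⟩
  refine hx₀.radSubmodule_ne_top hΓ hp (eq_top_iff.2 fun y _ => ?_)
  rw [← LinearMap.id_apply (R := BoundQuiverAlgebra I) y, ← hσ]
  exact (σ y).2

end IsTopElement

end Sufficiency

theorem mainTheorem3_general {K : Type u} [Field K]
    {Γ : Type v} [Quiver.{w} Γ] [Fintype Γ] [DecidableEq Γ]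
    (hΓ : IsTriangularQuiver Γ)
    (I : TwoSidedIdeal (PathAlgebra K Γ)) (hmon : IsMonomialIdeal I)
    (U : Type (max u v w)) [AddCommGroup U] [Module (BoundQuiverAlgebra I) U]
    {a b : Γ} (p : Quiver.Path a b) (hp : IsMast I U p) :
    IsIrreducibleHom (radSubmodule (BoundQuiverAlgebra I) U).subtype ↔
      ¬ IsSimpleModule (BoundQuiverAlgebra I) U ∧
      ((∀ (x y : Γ) (β : x ⟶ y), IsB p β →
          ∀ u : Quiver.Path a x, IsRightSubpath u p →
            arrowClass I β * pathClass I u = 0) ∧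
        (∀ (x y : Γ) (δ : x ⟶ y), IsD p δ →
          ∀ u : Quiver.Path a x, IsRightSubpath u p →
            arrowClass I δ * pathClass I u = 0)) ∧
      (∀ (z t : Γ) (β' : z ⟶ t), IsB' p β' → arrowClass I β' * pathClass I p ≠ 0 →
        (∀ (x y : Γ) (γ : x ⟶ y), IsC p γ →
          ∀ r : Quiver.Path y b, IsLeftSubpath r p →
            arrowClass I β' * pathClass I r * arrowClass I γ = 0) ∧
        (∀ (x y : Γ) (δ : x ⟶ y), IsD p δ →
          ∀ r : Quiver.Path y b, IsLeftSubpath r p →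
            arrowClass I β' * pathClass I r * arrowClass I δ = 0)) := by
  rw [← rightDeviationsVanish_iff I hΓ, ← leftDeviationsVanish_iff I hΓ]
  let : Module K U := Module.compHom U (algebraMap K (BoundQuiverAlgebra I))
  have : IsScalarTower K (BoundQuiverAlgebra I) U := .of_algebraMap_smul fun _ _ => rfl
  obtain ⟨x₀, hx₀⟩ := hp.exists_isTopElement
  rw [hp.isSimpleModule_iff hΓ]
  constructor
  · intro hirr
    exact ⟨fun hab => hirr.not_isSimpleModule ((hp.isSimpleModule_iff hΓ).2 hab),
      rightDeviationsVanish_of_isIrreducibleHom hΓ hp hirr hmon,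
      leftDeviationsVanish_of_isIrreducibleHom hΓ hp hirr hmon⟩
  · rintro ⟨hab, hright, hleft⟩
    refine ⟨hx₀.not_isSplitMonoHom_radSubmodule_subtype hΓ hp hab,
      hx₀.not_isSplitEpiHom_radSubmodule_subtype hΓ hp, fun V _ _ _ g h hhg => ?_⟩
    let : Module K V := Module.compHom V (algebraMap K (BoundQuiverAlgebra I))
    have : IsScalarTower K (BoundQuiverAlgebra I) V := .of_algebraMap_smul fun _ _ => rfl
    exact isSplitMonoHom_or_isSplitEpiHom hΓ hx₀ hp hright hleft hhg
      (n₀ := ⟨_, hΓ.pathClass_smul_mem_radSubmodule I p hab x₀⟩) rfl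

theorem mainTheorem3 {K : Type u} [Field K]
    {Γ : Type v} [Quiver.{w} Γ] [Fintype Γ] [DecidableEq Γ] [∀ a b : Γ, Finite (a ⟶ b)]
    (hΓ : IsTriangularQuiver Γ)
    (I : TwoSidedIdeal (PathAlgebra K Γ)) (hadm : IsAdmissibleIdeal I) (hmon : IsMonomialIdeal I)
    (U : Type (max u v w)) [AddCommGroup U] [Module (BoundQuiverAlgebra I) U]
    [Module.Finite (BoundQuiverAlgebra I) U] (hU : IsUniserialModule (BoundQuiverAlgebra I) U)
    {a b : Γ} (p : Quiver.Path a b) (hp : IsMast I U p) :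
    IsIrreducibleHom (radSubmodule (BoundQuiverAlgebra I) U).subtype ↔
      ¬ IsSimpleModule (BoundQuiverAlgebra I) U ∧
      ((∀ (x y : Γ) (β : x ⟶ y), IsB p β →
          ∀ u : Quiver.Path a x, IsRightSubpath u p →
            arrowClass I β * pathClass I u = 0) ∧
        (∀ (x y : Γ) (δ : x ⟶ y), IsD p δ →
          ∀ u : Quiver.Path a x, IsRightSubpath u p →
            arrowClass I δ * pathClass I u = 0)) ∧
      (∀ (z t : Γ) (β' : z ⟶ t), IsB' p β' → arrowClass I β' * pathClass I p ≠ 0 →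
        (∀ (x y : Γ) (γ : x ⟶ y), IsC p γ →
          ∀ r : Quiver.Path y b, IsLeftSubpath r p →
            arrowClass I β' * pathClass I r * arrowClass I γ = 0) ∧
        (∀ (x y : Γ) (δ : x ⟶ y), IsD p δ →
          ∀ r : Quiver.Path y b, IsLeftSubpath r p →
            arrowClass I β' * pathClass I r * arrowClass I δ = 0)) :=
  mainTheorem3_general hΓ I hmon U p hp
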